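/- Let $E=(E^0,E^1,r,s)$ be a finite acyclic directed graph (loops excluded by acyclicity, multiple edges allowed), and let $k\ge 1$ be an integer. Let $C^*(E)$ be the graph $C^*$-algebra of $E$, i.e. the universal $C^*$-algebra generated by mutually orthogonal projections $P_v$ ($v\in E^0$) and partial isometries $S_e$ ($e\in E^1$) with mutually orthogonal ranges such that $S_e^*S_e=P_{r(e)}$, $S_eS_e^*\le P_{s(e)}$, and $P_v=\sum_{s(e)=v}S_eS_e^*$ for every vertex $v$ that is not a sink (a sink is a vertex that emits no edge). Let the group $\mathbb{Z}/k=\{\lambda\in\mathbb{C}:\lambda^k=1\}$ act on $C^*(E)$ by the restriction of the gauge action, $\lambda\cdot P_v=P_v$ and $\lambda\cdot S_e=\lambda S_e$. For an action of a compact group $G$ on a unital $C^*$-algebra $A$, the weak local-triviality dimension $\dim^{G}_{\mathrm{WLT}}(A)\in\mathbb{N}\cup\{\infty\}$ is the smallest $n\ge 0$ for which there are $G$-equivariant $*$-homomorphisms $\rho_0,\dots,\rho_n: C_0((0,1])\otimes C(G)\to A$ such that $\sum_{i=0}^n\rho_i(t\otimes 1)$ is invertible, and $\infty$ if there is no such $n$;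 here $t$ is the identity function in $C_0((0,1])$, and $G$ acts on $C(G)$ by $(g\cdot f)(h)=f(hg)$ and trivially on $C_0((0,1])$. For a sink $v$ and a residue $i\in\{0,\dots,k-1\}$ let $\#^v_i$ be the number of directed paths in $E$ (the path of length $0$ at $v$ included) that end at $v$ and have length congruent to $i$ modulo $k$, and let $$\mathrm{quot}^v=\left\lceil \frac{\max_i \#^v_i}{\min_j \#^v_j}\right\rceil ,$$ with $\mathrm{quot}^v=\infty$ if the denominator is $0$. Then $$\dim^{\mathbb{Z}/k}_{\mathrm{WLT}}(C^*(E))=\max_{v\ \text{a sink of}\ E}\,(\mathrm{quot}^v-1),$$ where $\infty-1=\infty$ and, for the empty graph, the maximum over the empty set is $0$. -/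

import Mathlib

open scoped ENNReal ZeroAtInfty

universe u v w

noncomputable section

/-! ## Directed graphs

A directed graph is a `Quiver` on its type of vertices; loops and multiple edges are allowed. An edge
`e : a ⟶ b` has source `a` and range `b`, and `Quiver.Total V` is the type of all edges. Paths are
`Quiver.Path`s, read from left to right; the paths of length `0` are the vertices. -/

/-- There is no closed path of positive length. -/
def Quiver.Acyclic (V : Type u) [Quiver.{v} V] : Prop :=
  ∀ (a : V) (p : Quiver.Path a a), p.length = 0

/-- A sink is a vertex that emits no edge. -/
def Quiver.IsSink {V : Type u} [Quiver.{v} V] (a : V) : Prop :=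
  IsEmpty (Quiver.Star a)

/-- The number of paths that end at `a` and whose length is congruent to `i` modulo `k`. -/
def Quiver.pathCount {V : Type u} [Quiver.{v} V] (a : V) (k : ℕ) (i : ZMod k) : ℕ :=
  Nat.card {p : Σ b : V, Quiver.Path b a // (p.2.length : ZMod k) = i}

/-- The ceiling of the largest of the numbers `pathCount a k i` over the smallest of them, where `i`
runs over the residues modulo `k`; it is `∞` if the smallest one is `0`. -/
def Quiver.quot {V : Type u} [Quiver.{v} V] (a : V) (k : ℕ) [NeZero k] : ℕ∞ :=
  let M : ℕ := Finset.univ.sup' Finset.univ_nonempty (Quiver.pathCount a k)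
  let m : ℕ := Finset.univ.inf' Finset.univ_nonempty (Quiver.pathCount a k)
  if m = 0 then ⊤ else ((⌈(M : ℚ) / (m : ℚ)⌉₊ : ℕ) : ℕ∞)

/-! ## Graph C*-algebras -/

/-- A Cuntz–Krieger family of a directed graph in a C*-algebra `B`. -/
structure CuntzKriegerFamily (V : Type u) [Quiver.{v} V] (B : Type w) [NonUnitalCStarAlgebra B] where
  P : V → B
  S : Quiver.Total V → B
  isStarProjection_P : ∀ a, IsStarProjection (P a)
  P_mul_P : ∀ a b, a ≠ b → P a * P b = 0
  /-- Every `S e` is a partial isometry. -/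
  S_mul_star_mul_S : ∀ e, S e * star (S e) * S e = S e
  /-- The range projections of distinct `S e` and `S f` are orthogonal. -/
  range_mul_range : ∀ e f, e ≠ f → (S e * star (S e)) * (S f * star (S f)) = 0
  star_S_mul_S : ∀ e, star (S e) * S e = P e.right
  /-- The range projection of `S e` lies below the projection of the source of `e`: for projections
  `p` and `q`, the relation `p ≤ q` means `q * p = p`. -/
  range_le : ∀ e, P e.left * (S e * star (S e)) = S e * star (S e)
  /-- If `a` emits at least one and only finitely many edges, then `P a` is the sum of the range
  projections of these edges. -/
  P_eq_sum : ∀ a : V, Nonempty (Quiver.Star a) → Finite (Quiver.Star a) →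
    P a = ∑ᶠ e : Quiver.Star a, S ⟨a, e.1, e.2⟩ * star (S ⟨a, e.1, e.2⟩)

namespace CuntzKriegerFamily

variable {V : Type u} [Quiver.{v} V] {B : Type w} [NonUnitalCStarAlgebra B]

theorem norm_P_le (F : CuntzKriegerFamily V B) (a : V) : ‖F.P a‖ ≤ 1 :=
  (F.isStarProjection_P a).norm_le

theorem norm_S_le (F : CuntzKriegerFamily V B) (e : Quiver.Total V) : ‖F.S e‖ ≤ 1 := by
  have h : ‖F.S e‖ * ‖F.S e‖ ≤ 1 := by
    rw [← CStarRing.norm_star_mul_self, F.star_S_mul_S]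
    exact F.norm_P_le _
  nlinarith [norm_nonneg (F.S e)]

/-- Multiply every `S e` by the complex number `z` of modulus one. -/
def rotate (z : Circle) (F : CuntzKriegerFamily V B) : CuntzKriegerFamily V B :=
  have h1 : (z : ℂ) * star (z : ℂ) = 1 := by
    rw [RCLike.star_def, Complex.mul_conj, Complex.normSq_eq_norm_sq, Circle.norm_coe]; simp
  have hz : ∀ x y : B, ((z : ℂ) • x) * star ((z : ℂ) • y) = x * star y := fun x y => by
    rw [star_smul, smul_mul_smul_comm, h1, one_smul]
  have hz' : ∀ x y : B, star ((z : ℂ) • x) * ((z : ℂ) • y) = star x * y := fun x y => by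
    rw [star_smul, smul_mul_smul_comm, mul_comm, h1, one_smul]
  { P := F.P
    S := fun e => (z : ℂ) • F.S e
    isStarProjection_P := F.isStarProjection_P
    P_mul_P := F.P_mul_P
    S_mul_star_mul_S := fun e => by rw [hz, mul_smul_comm, F.S_mul_star_mul_S]
    range_mul_range := fun e f h => by rw [hz, hz, F.range_mul_range e f h]
    star_S_mul_S := fun e => by rw [hz', F.star_S_mul_S]
    range_le := fun e => by rw [hz, F.range_le]
    P_eq_sum := fun a h h' => by simp only [hz]; exact F.P_eq_sum a h h' }

end CuntzKriegerFamily

/-- A C*-algebra together with a Cuntz–Krieger family in it. -/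
structure CuntzKriegerRep (V : Type u) [Quiver.{v} V] : Type (max u v + 1) where
  carrier : Type (max u v)
  [cstar : NonUnitalCStarAlgebra carrier]
  family : CuntzKriegerFamily V carrier

attribute [instance] CuntzKriegerRep.cstar

/-- Multiply the partial isometries by the complex number `z` of modulus one. -/
def CuntzKriegerRep.rotate {V : Type u} [Quiver.{v} V] (z : Circle) (F : CuntzKriegerRep V) :
    CuntzKriegerRep V where
  carrier := F.carrier
  family := F.family.rotate z

/-- The bounded families with one entry for each Cuntz–Krieger family. -/
abbrev CuntzKriegerProduct (V : Type u) [Quiver.{v} V] : Type (max u v + 1) :=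
  lp (fun F : CuntzKriegerRep V => F.carrier) ∞

namespace CuntzKriegerProduct

variable {V : Type u} [Quiver.{v} V]

/-- The tuple of the projections of `a` in all Cuntz–Krieger families. -/
def P (a : V) : CuntzKriegerProduct V :=
  ⟨fun F => F.family.P a, memℓp_infty ⟨1, by rintro _ ⟨F, rfl⟩; exact F.family.norm_P_le a⟩⟩

/-- The tuple of the partial isometries of `e` in all Cuntz–Krieger families. -/
def S (e : Quiver.Total V) : CuntzKriegerProduct V :=
  ⟨fun F => F.family.S e, memℓp_infty ⟨1, by rintro _ ⟨F, rfl⟩; exact F.family.norm_S_le e⟩⟩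

/-- The *-endomorphism that permutes the entries along `CuntzKriegerRep.rotate z`. -/
def rotateHom (z : Circle) : CuntzKriegerProduct V →⋆ₙₐ[ℂ] CuntzKriegerProduct V where
  toFun x := ⟨fun F => x (F.rotate z), memℓp_infty <| by
    obtain ⟨C, hC⟩ := memℓp_infty_iff.1 (lp.memℓp x)
    exact ⟨C, by rintro _ ⟨F, rfl⟩; exact hC ⟨F.rotate z, rfl⟩⟩⟩
  map_smul' _ _ := rfl
  map_zero' := rfl
  map_add' _ _ := rfl
  map_mul' _ _ := rfl
  map_star' _ := rfl

end CuntzKriegerProduct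

/-- The closed *-subalgebra generated by the tuples `P a` and `S e`. -/
def GraphCStar.subalgebra (V : Type u) [Quiver.{v} V] :
    NonUnitalStarSubalgebra ℂ (CuntzKriegerProduct V) :=
  (NonUnitalStarAlgebra.adjoin ℂ
    (Set.range CuntzKriegerProduct.P ∪ Set.range CuntzKriegerProduct.S)).topologicalClosure

/-- The graph C*-algebra: the universal C*-algebra generated by a Cuntz–Krieger family. It is
realized as the C*-algebra generated by the tuple of all Cuntz–Krieger families. Since a
C*-algebra generated by a Cuntz–Krieger family has a copy in `Type (max u v)` if the graph is
countable, the choice of this universe is no restriction. -/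
def GraphCStar (V : Type u) [Quiver.{v} V] : Type (max u v + 1) :=
  GraphCStar.subalgebra V

namespace GraphCStar

variable (V : Type u) [Quiver.{v} V]

instance : NonUnitalCStarAlgebra (GraphCStar V) :=
  NonUnitalStarSubalgebra.nonUnitalCStarAlgebra (subalgebra V)
    (h_closed := NonUnitalStarSubalgebra.isClosed_topologicalClosure _)

variable {V}

theorem P_mem (a : V) : CuntzKriegerProduct.P a ∈ subalgebra V :=
  NonUnitalStarSubalgebra.le_topologicalClosure _
    (NonUnitalStarAlgebra.subset_adjoin ℂ _ (Or.inl ⟨a, rfl⟩))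

theorem S_mem (e : Quiver.Total V) : CuntzKriegerProduct.S e ∈ subalgebra V :=
  NonUnitalStarSubalgebra.le_topologicalClosure _
    (NonUnitalStarAlgebra.subset_adjoin ℂ _ (Or.inr ⟨e, rfl⟩))

/-- The projection of the vertex `a` in the graph C*-algebra. -/
def P (a : V) : GraphCStar V := ⟨CuntzKriegerProduct.P a, P_mem a⟩

/-- The partial isometry of the edge `e` in the graph C*-algebra. -/
def S (e : Quiver.Total V) : GraphCStar V := ⟨CuntzKriegerProduct.S e, S_mem e⟩

/-- The projection of the product onto one factor, restricted to the graph C*-algebra. It is the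
*-homomorphism whose existence the universal property requires. -/
def lift (F : CuntzKriegerRep V) : GraphCStar V →⋆ₙₐ[ℂ] F.carrier where
  toFun x := x.1 F
  map_smul' _ _ := rfl
  map_zero' := rfl
  map_add' _ _ := rfl
  map_mul' _ _ := rfl
  map_star' _ := rfl

theorem lift_apply (F : CuntzKriegerRep V) (x : GraphCStar V) : lift F x = x.1 F := rfl

theorem lift_P (F : CuntzKriegerRep V) (a : V) : lift F (P a) = F.family.P a := rfl

theorem lift_S (F : CuntzKriegerRep V) (e : Quiver.Total V) : lift F (S e) = F.family.S e := rfl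

theorem ext_lift {x y : GraphCStar V} (h : ∀ F : CuntzKriegerRep V, lift F x = lift F y) : x = y :=
  Subtype.ext (Subtype.ext (funext h))

/-- The graph C*-algebra is generated by the elements `P a` and `S e`. -/
theorem mem_of_generators (T : NonUnitalStarSubalgebra ℂ (GraphCStar V))
    (hT : IsClosed (T : Set (GraphCStar V))) (hP : ∀ a, P a ∈ T) (hS : ∀ e, S e ∈ T)
    (x : GraphCStar V) : x ∈ T := by
  have hadj : ∀ y (hy : y ∈ NonUnitalStarAlgebra.adjoin ℂ
      (Set.range CuntzKriegerProduct.P ∪ Set.range CuntzKriegerProduct.S)),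
      (⟨y, NonUnitalStarSubalgebra.le_topologicalClosure _ hy⟩ : GraphCStar V) ∈ T := by
    intro y hy
    induction hy using NonUnitalStarAlgebra.adjoin_induction with
    | mem y hy =>
      obtain ⟨a, rfl⟩ | ⟨e, rfl⟩ := hy
      exacts [hP a, hS e]
    | add y z hy hz h1 h2 => exact add_mem h1 h2
    | zero => exact zero_mem T
    | mul y z hy hz h1 h2 => exact mul_mem h1 h2
    | smul r y hy h1 => exact T.smul_mem' r h1
    | star y hy h1 => exact T.star_mem' h1
  have hx : x ∈ closure (T : Set (GraphCStar V)) := by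
    have hind : Topology.IsInducing (Subtype.val : GraphCStar V → CuntzKriegerProduct V) :=
      Topology.IsInducing.subtypeVal
    have hcl : closure (T : Set (GraphCStar V)) =
        Subtype.val ⁻¹' closure (Subtype.val '' (T : Set (GraphCStar V))) :=
      hind.closure_eq_preimage_closure_image _
    rw [hcl]
    refine closure_mono ?_ x.2
    intro y hy
    exact ⟨_, hadj y hy, rfl⟩
  rwa [hT.closure_eq] at hx

/-- The tuple of all Cuntz–Krieger families is a Cuntz–Krieger family. -/
def family (V : Type u) [Quiver.{v} V] : CuntzKriegerFamily V (GraphCStar V) where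
  P := P
  S := S
  isStarProjection_P a := by
    constructor
    · exact Subtype.ext (Subtype.ext (funext fun F => (F.family.isStarProjection_P a).1))
    · exact Subtype.ext (Subtype.ext (funext fun F => (F.family.isStarProjection_P a).2))
  P_mul_P a b h := Subtype.ext (Subtype.ext (funext fun F => F.family.P_mul_P a b h))
  S_mul_star_mul_S e := Subtype.ext (Subtype.ext (funext fun F => F.family.S_mul_star_mul_S e))
  range_mul_range e f h :=
    Subtype.ext (Subtype.ext (funext fun F => F.family.range_mul_range e f h))
  star_S_mul_S e := Subtype.ext (Subtype.ext (funext fun F => F.family.star_S_mul_S e))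
  range_le e := Subtype.ext (Subtype.ext (funext fun F => F.family.range_le e))
  P_eq_sum a h h' := by
    have := Fintype.ofFinite (Quiver.Star a)
    rw [finsum_eq_sum_of_fintype]
    refine Subtype.ext (Subtype.ext (funext fun F => ?_))
    have h1 := F.family.P_eq_sum a h h'
    rw [finsum_eq_sum_of_fintype] at h1
    refine h1.trans ?_
    exact (map_sum (lift F) (fun e : Quiver.Star a => S ⟨a, e.1, e.2⟩ * star (S ⟨a, e.1, e.2⟩))
      Finset.univ).symm

/-- A *-homomorphism on the graph C*-algebra is determined by its values on the generators. -/
theorem hom_ext {B : Type w} [NonUnitalCStarAlgebra B] {f g : GraphCStar V →⋆ₙₐ[ℂ] B}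
    (hP : ∀ a, f (P a) = g (P a)) (hS : ∀ e, f (S e) = g (S e)) : f = g := by
  have hf : Continuous f := AddMonoidHomClass.continuous_of_bound f 1 fun x => by
    simpa using NonUnitalStarAlgHom.norm_apply_le f x
  have hg : Continuous g := AddMonoidHomClass.continuous_of_bound g 1 fun x => by
    simpa using NonUnitalStarAlgHom.norm_apply_le g x
  ext x
  exact mem_of_generators (NonUnitalStarAlgHom.equalizer f g) (isClosed_eq hf hg) hP hS x

theorem rotateHom_mem (z : Circle) (x : GraphCStar V) :
    CuntzKriegerProduct.rotateHom z x.1 ∈ subalgebra V := by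
  have hc : Continuous (CuntzKriegerProduct.rotateHom (V := V) z) :=
    AddMonoidHomClass.continuous_of_bound _ 1 fun x => by
      simpa using NonUnitalStarAlgHom.norm_apply_le (CuntzKriegerProduct.rotateHom z) x
  let ι : GraphCStar V →⋆ₙₐ[ℂ] CuntzKriegerProduct V :=
    NonUnitalStarSubalgebraClass.subtype (subalgebra V)
  refine mem_of_generators
    ((subalgebra V).comap ((CuntzKriegerProduct.rotateHom z).comp ι))
    ((NonUnitalStarSubalgebra.isClosed_topologicalClosure _).preimage
      (hc.comp continuous_subtype_val)) (fun a => P_mem a) (fun e => ?_) x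
  exact (subalgebra V).smul_mem' (z : ℂ) (S_mem e)

/-- The *-endomorphism that fixes every `P a` and maps `S e` to `z • S e`. -/
def gaugeHom (z : Circle) : GraphCStar V →⋆ₙₐ[ℂ] GraphCStar V where
  toFun x := ⟨CuntzKriegerProduct.rotateHom z x.1, rotateHom_mem z x⟩
  map_smul' _ _ := rfl
  map_zero' := rfl
  map_add' _ _ := rfl
  map_mul' _ _ := rfl
  map_star' _ := rfl

theorem gaugeHom_P (z : Circle) (a : V) : gaugeHom z (P a) = P a := rfl

theorem gaugeHom_S (z : Circle) (e : Quiver.Total V) : gaugeHom z (S e) = (z : ℂ) • S e := rfl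

theorem gaugeHom_mul (z z' : Circle) :
    gaugeHom (V := V) (z * z') = (gaugeHom z).comp (gaugeHom z') := by
  refine hom_ext (fun a => rfl) fun e => ?_
  rw [NonUnitalStarAlgHom.comp_apply, gaugeHom_S, gaugeHom_S, map_smul, gaugeHom_S, smul_smul,
    Circle.coe_mul, mul_comm]

theorem gaugeHom_one : gaugeHom (V := V) 1 = NonUnitalStarAlgHom.id ℂ (GraphCStar V) := by
  refine hom_ext (fun a => rfl) fun e => ?_
  rw [gaugeHom_S]
  simp

/-- The gauge action of the circle: `gauge V z` fixes every `P a` and maps `S e` to `z • S e`. -/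
def gauge (V : Type u) [Quiver.{v} V] : Circle →* (GraphCStar V ≃⋆ₐ[ℂ] GraphCStar V) where
  toFun z := StarAlgEquiv.ofNonUnitalStarAlgHom (gaugeHom z) (gaugeHom z⁻¹)
    (by rw [← gaugeHom_mul, inv_mul_cancel, gaugeHom_one])
    (by rw [← gaugeHom_mul, mul_inv_cancel, gaugeHom_one])
  map_one' := StarAlgEquiv.ext fun x => DFunLike.congr_fun gaugeHom_one x
  map_mul' z z' := StarAlgEquiv.ext fun x => DFunLike.congr_fun (gaugeHom_mul z z') x

theorem gauge_P (z : Circle) (a : V) : gauge V z (P a) = P a := rfl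

theorem gauge_S (z : Circle) (e : Quiver.Total V) : gauge V z (S e) = (z : ℂ) • S e := rfl

/-- The sum of the vertex projections. -/
def unit (V : Type u) [Quiver.{v} V] : GraphCStar V := ∑ᶠ a : V, P a

section Unit

variable [Finite V]

theorem isSelfAdjoint_unit : star (unit V) = unit V := by
  have := Fintype.ofFinite V
  rw [unit, finsum_eq_sum_of_fintype, star_sum]
  exact Finset.sum_congr rfl fun a _ => ((family V).isStarProjection_P a).2

theorem unit_mul_P (a : V) : unit V * P a = P a := by
  have := Fintype.ofFinite V
  rw [unit, finsum_eq_sum_of_fintype, Finset.sum_mul, Finset.sum_eq_single a]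
  · exact ((family V).isStarProjection_P a).1
  · exact fun b _ h => (family V).P_mul_P b a h
  · exact fun h => absurd (Finset.mem_univ a) h

theorem P_mul_unit (a : V) : P a * unit V = P a := by
  have h := congrArg star (unit_mul_P a)
  have h' : star (P a) = P a := ((family V).isStarProjection_P a).2
  rwa [star_mul, isSelfAdjoint_unit, h'] at h

theorem unit_mul_and_mul_unit (x : GraphCStar V) : unit V * x = x ∧ x * unit V = x := by
  let T : NonUnitalStarSubalgebra ℂ (GraphCStar V) :=
    { carrier := {x | unit V * x = x ∧ x * unit V = x}
      add_mem' := fun h h' => by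
        exact ⟨by rw [mul_add, h.1, h'.1], by rw [add_mul, h.2, h'.2]⟩
      zero_mem' := ⟨mul_zero _, zero_mul _⟩
      mul_mem' := fun h h' => by
        exact ⟨by rw [← mul_assoc, h.1], by rw [mul_assoc, h'.2]⟩
      smul_mem' := fun c y h => by
        exact ⟨by rw [mul_smul_comm, h.1], by rw [smul_mul_assoc, h.2]⟩
      star_mem' := fun {y} h => by
        refine ⟨?_, ?_⟩
        · have := congrArg star h.2
          rwa [star_mul, isSelfAdjoint_unit] at this
        · have := congrArg star h.1
          rwa [star_mul, isSelfAdjoint_unit] at this }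
  refine mem_of_generators T ?_ (fun a => ⟨unit_mul_P a, P_mul_unit a⟩) (fun e => ?_) x
  · exact (isClosed_eq (continuous_const_mul _) continuous_id).inter
      (isClosed_eq (continuous_mul_const _) continuous_id)
  · have h1 : P e.left * S e = S e := by
      have h := congrArg (· * S e) ((family V).range_le e)
      have h' : S e * star (S e) * S e = S e := (family V).S_mul_star_mul_S e
      have h'' : P e.left * (S e * star (S e)) * S e = S e * star (S e) * S e := h
      rwa [mul_assoc, h'] at h''
    have h2 : S e * P e.right = S e := by
      have h : star (S e) * S e = P e.right := (family V).star_S_mul_S e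
      rw [← h, ← mul_assoc]
      exact (family V).S_mul_star_mul_S e
    refine ⟨?_, ?_⟩
    · rw [← h1, ← mul_assoc, unit_mul_P]
    · rw [← h2, mul_assoc, P_mul_unit]

/-- If there are only finitely many vertices, then the sum of their projections is the unit. -/
instance : NormedRing (GraphCStar V) :=
  { (inferInstance : NonUnitalNormedRing (GraphCStar V)) with
    one := unit V
    one_mul := fun x => (unit_mul_and_mul_unit x).1
    mul_one := fun x => (unit_mul_and_mul_unit x).2 }

instance : NormedAlgebra ℂ (GraphCStar V) :=
  { Algebra.ofModule (R := ℂ) (A := GraphCStar V) smul_mul_assoc mul_smul_comm with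
    norm_smul_le := norm_smul_le }

instance : CStarAlgebra (GraphCStar V) where
  norm_mul_self_le := CStarRing.norm_mul_self_le

theorem one_def : (1 : GraphCStar V) = ∑ᶠ a : V, P a := rfl

end Unit

end GraphCStar

/-! ## The weak local-triviality dimension -/

section WeakDimension

variable (G : Type w) [Group G] [TopologicalSpace G]

/-- The C*-algebra `C₀((0,1]) ⊗ C(G)`, realized as `C₀((0,1] × G)`. -/
abbrev ConeAlgebra : Type w := C₀(Set.Ioc (0 : ℝ) 1 × G, ℂ)

namespace ConeAlgebra

variable {G}

/-- The action of `G` by right translation in the second variable: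
`(translate g f) (s, h) = f (s, h * g)`. -/
def translate [ContinuousMul G] (g : G) (f : ConeAlgebra G) : ConeAlgebra G :=
  f.comp ((Homeomorph.refl (Set.Ioc (0 : ℝ) 1)).prodCongr (Homeomorph.mulRight g)).toCocompactMap

theorem translate_apply [ContinuousMul G] (g : G) (f : ConeAlgebra G) (s : Set.Ioc (0 : ℝ) 1)
    (h : G) : translate g f (s, h) = f (s, h * g) := rfl

variable (G) in
/-- The element `t ⊗ 1`, where `t` is the identity function: `(s, h) ↦ s`. -/
def t [CompactSpace G] : ConeAlgebra G where
  toFun p := ((p.1 : ℝ) : ℂ)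
  continuous_toFun := by fun_prop
  zero_at_infty' := by
    rw [Metric.tendsto_nhds]
    intro ε hε
    let K : Set (Set.Ioc (0 : ℝ) 1) := Subtype.val ⁻¹' Set.Icc ε 1
    have hK : IsCompact K := by
      refine Topology.IsInducing.subtypeVal.isCompact_preimage_iff ?_ |>.2 isCompact_Icc
      intro x hx
      exact ⟨⟨x, lt_of_lt_of_le hε hx.1, hx.2⟩, rfl⟩
    refine Filter.mem_of_superset (hK.prod isCompact_univ).compl_mem_cocompact ?_
    rintro ⟨s, h⟩ hs
    have hs' : ¬ (ε ≤ (s : ℝ) ∧ (s : ℝ) ≤ 1) := fun h' => hs ⟨h', Set.mem_univ h⟩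
    have h1 : (s : ℝ) < ε := by
      by_contra h2
      exact hs' ⟨not_lt.1 h2, s.2.2⟩
    simpa [abs_of_pos s.2.1] using h1

end ConeAlgebra

variable {G}

/-- The weak local-triviality dimension of an action `α` of the compact group `G` on the unital
C*-algebra `A`: the smallest `n` for which there are `n + 1` equivariant *-homomorphisms
`ρ i : C₀((0,1]) ⊗ C(G) → A` such that the sum of the `ρ i (t ⊗ 1)` is invertible, and `∞` if there
is no such `n`. -/
def weakLocalTrivialityDim [ContinuousMul G] [CompactSpace G] {A : Type u} [CStarAlgebra A]
    (α : G →* (A ≃⋆ₐ[ℂ] A)) : ℕ∞ :=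
  sInf {d : ℕ∞ | ∃ n : ℕ, d = n ∧ ∃ ρ : Fin (n + 1) → (ConeAlgebra G →⋆ₙₐ[ℂ] A),
    (∀ i g f, ρ i (ConeAlgebra.translate g f) = α g (ρ i f)) ∧
    IsUnit (∑ i, ρ i (ConeAlgebra.t G))}

end WeakDimension

/-! ## The cyclic subgroups of the circle -/

/-- The cyclic group of order `k`, as the group of all complex `k`-th roots of unity. -/
def cyclicSubgroup (k : ℕ) : Subgroup Circle := (powMonoidHom k : Circle →* Circle).ker

instance (k : ℕ) : CompactSpace (cyclicSubgroup k) :=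
  isCompact_iff_compactSpace.1 (IsClosed.isCompact
    (isClosed_eq (continuous_pow k) continuous_const : IsClosed {z : Circle | z ^ k = 1}))

/-- The restriction of the gauge action to the cyclic group of order `k`. -/
def GraphCStar.cyclicGauge (V : Type u) [Quiver.{v} V] (k : ℕ) :
    cyclicSubgroup k →* (GraphCStar V ≃⋆ₐ[ℂ] GraphCStar V) :=
  (GraphCStar.gauge V).comp (cyclicSubgroup k).subtype

end

/-! For paths `p`, `q` ending at sinks, the Cuntz–Krieger relations turn the elements `S_p S_q^*`
(same sink) into matrix units, and the gauge action multiplies `S_p S_q^*` by `z ^ (|p| - |q|)`.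
Each sink thus contributes a matrix algebra graded by path length modulo `k`, with degree spaces of
dimension `pathCount`. Instead of an isomorphism with the sum of these algebras, one unital
homomorphism in each direction suffices: `sinkRep` for the lower bound, `sinkHom` for the upper.

Lower bound: `t ⊗ 1 = star f * f` with `f = √t ⊗ χ^l`, an eigenvector of translation. The matrix of
`ρ i f` shifts degree by `l`, so the invertible sum, cut down to class `j`, factors through `n + 1`
copies of class `j + l`. Comparing ranks gives `pathCount a k j ≤ (n + 1) * pathCount a k j'`
(`pathCount_le_of_weakLocalTriviality`).

Upper bound: given these inequalities, let `m` be the smallest class size at a sink. Each class is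
covered by `n + 1` subsets of size `m`, and the `i`-th subsets of all classes split into `m`
transversals with one path per residue. The constant vectors on these transversals span the range of
a projection; vanishing of nontrivial character sums makes it orthogonal to its translates, and the
translates sum to a nonzero multiple of the projection onto the paths used (`exists_projections`).
Such a projection yields an equivariant homomorphism (`ConeAlgebra.exists_equivariant_hom`), and the
covering makes the total sum invertible.

Both bounds meet in the same inequalities, which say `quot ≤ n + 1` (`quot_le_iff`). -/

/-! ### Paths in finite acyclic graphs -/

namespace Quiver

variable {V : Type u} [Quiver.{v} V]

/-- The paths that end at `a`. -/
abbrev PathTo (a : V) : Type max u v := Σ b : V, Path b a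

/-- On a finite vertex set this strict order is well founded in both directions, which allows
induction from the sources and from the sinks. -/
theorem Acyclic.irrefl_trans (h : Acyclic V) :
    Std.Irrefl (fun a b : V => ∃ p : Path a b, p.length ≠ 0) ∧
      IsTrans V (fun a b : V => ∃ p : Path a b, p.length ≠ 0) :=
  ⟨⟨fun a ⟨p, hp⟩ => hp (h a p)⟩,
    ⟨fun _ _ _ ⟨p, hp⟩ ⟨q, _⟩ => ⟨p.comp q, by rw [Path.length_comp]; omega⟩⟩⟩

theorem Acyclic.wellFounded [Finite V] (h : Acyclic V) :
    WellFounded fun a b : V => Nonempty (a ⟶ b) := by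
  obtain ⟨h1, h2⟩ := h.irrefl_trans
  refine Subrelation.wf (r := fun a b : V => ∃ p : Path a b, p.length ≠ 0) ?_
    (Finite.wellFounded_of_trans_of_irrefl _)
  rintro a b ⟨e⟩
  exact ⟨e.toPath, one_ne_zero⟩

theorem Acyclic.wellFounded_swap [Finite V] (h : Acyclic V) :
    WellFounded fun a b : V => Nonempty (b ⟶ a) := by
  obtain ⟨h1, h2⟩ := h.irrefl_trans
  refine Subrelation.wf (r := Function.swap fun a b : V => ∃ p : Path a b, p.length ≠ 0) ?_
    (Finite.wellFounded_of_trans_of_irrefl _)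
  rintro a b ⟨e⟩
  exact ⟨e.toPath, one_ne_zero⟩

/-- Induction along incoming edges: a path to `a` is trivial or a path to the source of its last
edge, followed by that edge. -/
theorem Acyclic.finite_pathTo [Finite V] [Finite (Total V)] (h : Acyclic V) (a : V) :
    Finite (PathTo a) := by
  induction a using h.wellFounded.induction with
  | _ a ih =>
    have : Finite (Costar a) :=
      Finite.of_injective (fun e : Costar a => (⟨e.1, a, e.2⟩ : Total V))
        fun ⟨_, _⟩ ⟨_, _⟩ h => by cases h; rfl
    have : ∀ e : Costar a, Finite (PathTo e.1) := fun e => ih _ ⟨e.2⟩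
    refine Finite.of_surjective
      (fun x : Option (Σ e : Costar a, PathTo e.1) =>
        match x with
        | none => (⟨a, Path.nil⟩ : PathTo a)
        | some ⟨e, p⟩ => ⟨p.1, p.2.cons e.2⟩) ?_
    rintro ⟨b, p⟩
    cases p with
    | nil => exact ⟨none, rfl⟩
    | cons p e => exact ⟨some ⟨⟨_, e⟩, ⟨_, p⟩⟩, rfl⟩

/-- The first edge of a path, if there is one. -/
def Path.firstEdge {a : V} : ∀ {b : V}, Path a b → Option (Total V)
  | _, Path.nil => none
  | _, Path.cons p e => some (p.firstEdge.getD ⟨_, _, e⟩)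

theorem Path.firstEdge_toPath_comp {a b c : V} (e : a ⟶ b) (p : Path b c) :
    (e.toPath.comp p).firstEdge = some ⟨a, b, e⟩ := by
  induction p with
  | nil => rfl
  | cons p f ih => rw [Path.comp_cons, Path.firstEdge, ih]; rfl

/-- `Prepend e q p` says that the path `q` is the edge `e` followed by the path `p`. -/
inductive Prepend {a : V} (e : Total V) : PathTo a → PathTo a → Prop
  | mk (p : Path e.right a) : Prepend e ⟨e.left, e.hom.toPath.comp p⟩ ⟨e.right, p⟩

namespace Prepend

variable {a : V} {e f : Total V} {p p' q q' : PathTo a}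

theorem left_unique (h : Prepend e q p) (h' : Prepend e q' p) : q = q' := by
  cases h; cases h'; rfl

theorem right_unique (h : Prepend e q p) (h' : Prepend e q p') : p = p' := by
  obtain ⟨p⟩ := h
  -- The index must be a variable before the second hypothesis can be destructed.
  generalize hq : (⟨e.left, e.hom.toPath.comp p⟩ : PathTo a) = q at h'
  obtain ⟨p'⟩ := h'
  have := Path.comp_injective_right _ (eq_of_heq (Sigma.mk.inj hq).2)
  rw [this]

theorem edge_unique (h : Prepend e q p) (h' : Prepend f q p') : e = f := by
  obtain ⟨p⟩ := h
  generalize hq : (⟨e.left, e.hom.toPath.comp p⟩ : PathTo a) = q at h'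
  obtain ⟨p'⟩ := h'
  have := congrArg (fun x : PathTo a => x.2.firstEdge) hq
  simpa only [Path.firstEdge_toPath_comp, Option.some.injEq] using this

theorem fst_left (h : Prepend e q p) : q.1 = e.left := by cases h; rfl

theorem fst_right (h : Prepend e q p) : p.1 = e.right := by cases h; rfl

theorem length_eq (h : Prepend e q p) : q.2.length = p.2.length + 1 := by
  cases h; rw [Path.length_comp, Path.length_toPath, add_comm]

theorem exists_of_fst_eq (h : p.1 = e.right) : ∃ q, Prepend e q p := by
  obtain ⟨b, p⟩ := p
  obtain ⟨c, d, e⟩ := e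
  dsimp at h
  subst h
  exact ⟨_, .mk (e := ⟨c, b, e⟩) p⟩

theorem exists_of_ne (h : q.1 ≠ a) :
    ∃ (e : Star q.1) (p : PathTo a), Prepend ⟨q.1, e.1, e.2⟩ q p := by
  obtain ⟨b, q⟩ := q
  obtain ⟨c, e, p, -, rfl⟩ := Path.eq_toPath_comp_of_length_eq_succ q (n := q.length - 1)
    (by have := mt (Path.eq_of_length_zero q) h; omega)
  exact ⟨⟨c, e⟩, ⟨c, p⟩, .mk (e := ⟨b, c, e⟩) p⟩

end Prepend

end Quiver

/-! ### Products of partial isometries along paths -/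

namespace CuntzKriegerFamily

open Quiver

variable {V : Type u} [Quiver.{v} V] {B : Type w} [NonUnitalCStarAlgebra B]
  (F : CuntzKriegerFamily V B)

theorem star_P (a : V) : star (F.P a) = F.P a := (F.isStarProjection_P a).2

theorem P_mul_self (a : V) : F.P a * F.P a = F.P a := (F.isStarProjection_P a).1

theorem S_mul_P (e : Total V) : F.S e * F.P e.right = F.S e := by
  rw [← F.star_S_mul_S, ← mul_assoc, F.S_mul_star_mul_S]

theorem P_mul_S (e : Total V) : F.P e.left * F.S e = F.S e := by
  rw [← F.S_mul_star_mul_S, ← mul_assoc, F.range_le]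

theorem star_S_mul_S_of_ne {e f : Total V} (h : e ≠ f) : star (F.S e) * F.S f = 0 := by
  have h1 : star (F.S e) = star (F.S e) * (F.S e * star (F.S e)) := by
    conv_lhs => rw [← F.S_mul_star_mul_S e]
    simp only [star_mul, star_star]
  rw [h1, ← F.S_mul_star_mul_S f, mul_assoc, ← mul_assoc (F.S e * _), F.range_mul_range e f h,
    zero_mul, mul_zero]

/-- The product of the partial isometries along a path. -/
def ofPath {a : V} : ∀ {b : V}, Path a b → B
  | _, Path.nil => F.P a
  | _, Path.cons p e => ofPath p * F.S ⟨_, _, e⟩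

theorem ofPath_cons {a b c : V} (p : Path a b) (e : b ⟶ c) :
    F.ofPath (p.cons e) = F.ofPath p * F.S ⟨_, _, e⟩ := rfl

theorem ofPath_mul_P {a b : V} (p : Path a b) : F.ofPath p * F.P b = F.ofPath p := by
  cases p with
  | nil => exact F.P_mul_self a
  | cons p e => rw [ofPath_cons, mul_assoc, F.S_mul_P ⟨_, _, e⟩]

theorem star_ofPath_mul_self {a b : V} (p : Path a b) :
    star (F.ofPath p) * F.ofPath p = F.P b := by
  induction p with
  | nil => rw [ofPath, F.star_P, F.P_mul_self]
  | cons p e ih =>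
    rw [ofPath_cons, star_mul, mul_assoc, ← mul_assoc (star (F.ofPath p)), ih,
      F.P_mul_S ⟨_, _, e⟩, F.star_S_mul_S]

/-- Strip the last edges: the inner product of the initial segments is zero or a vertex projection,
and then `star (S e) * S f` decides. The sigma type allows paths with different endpoints to be
compared. -/
theorem star_ofPath_mul_of_length_eq {a b : V} (p : Path a b) :
    ∀ {a' b' : V} (q : Path a' b'), p.length = q.length →
      star (F.ofPath p) * F.ofPath q = 0 ∨
        (⟨a, b, p⟩ : Σ a b : V, Path a b) = ⟨a', b', q⟩ := by
  induction p with
  | nil =>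
    intro a' b' q h
    cases q with
    | nil =>
      by_cases h : a = a'
      · subst h; exact Or.inr rfl
      · exact Or.inl (by rw [ofPath, ofPath, F.star_P, F.P_mul_P _ _ h])
    | cons q f => simp at h
  | @cons b c p e ih =>
    intro a' b' q h
    cases q with
    | nil => simp at h
    | @cons b₁ _ q f =>
      rw [ofPath_cons, ofPath_cons, star_mul, mul_assoc, ← mul_assoc (star (F.ofPath p))]
      obtain h0 | h0 := ih q (by simpa using h)
      · exact Or.inl (by rw [h0, zero_mul, mul_zero])
      · cases h0
        rw [F.star_ofPath_mul_self, F.P_mul_S ⟨_, _, f⟩]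
        by_cases hef : (⟨b, c, e⟩ : Total V) = ⟨b, b', f⟩
        · cases hef; exact Or.inr rfl
        · exact Or.inl (F.star_S_mul_S_of_ne hef)

/-- Shorten `q` to the length of `p`. A nonzero product would make `p` a proper initial segment of
`q`, but no edge leaves a sink. -/
theorem star_ofPath_mul_of_length_lt {a b : V} (hb : IsSink b) (p : Path a b) {a' b' : V}
    (q : Path a' b') (h : p.length < q.length) : star (F.ofPath p) * F.ofPath q = 0 := by
  induction q with
  | nil => simp at h
  | cons q f ih =>
    rw [ofPath_cons, ← mul_assoc]
    obtain h0 | h0 := (Nat.lt_succ_iff.1 h).lt_or_eq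
    · rw [ih h0, zero_mul]
    · obtain h1 | h1 := F.star_ofPath_mul_of_length_eq p q h0
      · rw [h1, zero_mul]
      · cases h1
        exact (hb.false ⟨_, f⟩).elim

/-- Distinct paths that end at sinks have orthogonal ranges. -/
theorem star_ofPath_mul_of_ne {a b : V} (hb : IsSink b) (p : Path a b) {a' b' : V}
    (hb' : IsSink b') (q : Path a' b')
    (h : (⟨b, a, p⟩ : Σ b : V, PathTo b) ≠ ⟨b', a', q⟩) :
    star (F.ofPath p) * F.ofPath q = 0 := by
  obtain h0 | h0 | h0 := lt_trichotomy p.length q.length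
  · exact F.star_ofPath_mul_of_length_lt hb p q h0
  · refine (F.star_ofPath_mul_of_length_eq p q h0).resolve_right fun h1 => h ?_
    cases h1; rfl
  · rw [← star_star (F.ofPath q), ← star_mul, F.star_ofPath_mul_of_length_lt hb' q p h0, star_zero]

end CuntzKriegerFamily

/-! ### Matrices of relations -/

noncomputable section

namespace Matrix

variable {X : Type*}

open Classical in
/-- The matrix with entries `0` and `1` of a relation. -/
def ofRel (r : X → X → Prop) : Matrix X X ℂ :=
  Matrix.of fun x y => if r x y then 1 else 0

open Classical in
theorem ofRel_apply (r : X → X → Prop) (x y : X) :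
    ofRel r x y = if r x y then 1 else 0 := rfl

theorem ofRel_of {r : X → X → Prop} {x y : X} (h : r x y) : ofRel r x y = 1 := if_pos h

theorem ofRel_of_not {r : X → X → Prop} {x y : X} (h : ¬ r x y) : ofRel r x y = 0 := if_neg h

theorem ofRel_congr {r s : X → X → Prop} (h : ∀ x y, r x y ↔ s x y) : ofRel r = ofRel s := by
  rw [funext fun x => funext fun y => propext (h x y)]

theorem ofRel_eq_zero {r : X → X → Prop} (h : ∀ x y, ¬ r x y) : ofRel r = 0 :=
  Matrix.ext fun x y => ofRel_of_not (h x y)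

theorem star_ofRel (r : X → X → Prop) : star (ofRel r) = ofRel fun x y => r y x := by
  ext x y
  rw [Matrix.star_apply, ofRel_apply, ofRel_apply]
  split_ifs <;> simp

/-- The hypothesis leaves at most one nonzero term in each entry, so no multiplicities arise. -/
theorem ofRel_mul_ofRel [Fintype X] {r s : X → X → Prop}
    (h : ∀ x y y' z, r x y → s y z → r x y' → s y' z → y = y') :
    ofRel r * ofRel s = ofRel fun x z => ∃ y, r x y ∧ s y z := by
  ext x z
  rw [Matrix.mul_apply]
  by_cases hy : ∃ y, r x y ∧ s y z
  · rw [ofRel_of hy]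
    obtain ⟨y, h1, h2⟩ := hy
    rw [Finset.sum_eq_single y, ofRel_of h1, ofRel_of h2, one_mul]
    · rintro y' - hy'
      by_cases h1' : r x y'
      · rw [ofRel_of_not fun h2' => hy' (h _ _ _ _ h1' h2' h1 h2), mul_zero]
      · rw [ofRel_of_not h1', zero_mul]
    · exact fun h => (h (Finset.mem_univ _)).elim
  · rw [ofRel_of_not (r := fun x z => ∃ y, r x y ∧ s y z) hy]
    refine Finset.sum_eq_zero fun y _ => ?_
    by_cases h1 : r x y
    · rw [ofRel_of_not fun h2 => hy ⟨y, h1, h2⟩, mul_zero]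
    · rw [ofRel_of_not h1, zero_mul]

end Matrix

/-! ### The representation on the paths ending at a sink -/

namespace CuntzKriegerFamily

open Quiver Matrix
open scoped Matrix.Norms.L2Operator

variable {V : Type u} [Quiver.{v} V] {a : V}

theorem ofRel_prepend_mul_star [Fintype (PathTo a)] (e : Total V) :
    ofRel (X := PathTo a) (Prepend e) * star (ofRel (Prepend e)) =
      ofRel fun q q' => q = q' ∧ ∃ p, Prepend e q p := by
  rw [star_ofRel, ofRel_mul_ofRel fun _ _ _ _ h _ h' _ => h.right_unique h']
  refine ofRel_congr fun q q' => ⟨?_, ?_⟩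
  · rintro ⟨p, h, h'⟩
    exact ⟨h.left_unique h', p, h⟩
  · rintro ⟨rfl, p, h⟩
    exact ⟨p, h, h⟩

theorem star_ofRel_prepend_mul [Fintype (PathTo a)] (e : Total V) :
    star (ofRel (X := PathTo a) (Prepend e)) * ofRel (Prepend e) =
      ofRel fun p p' => p = p' ∧ p.1 = e.right := by
  rw [star_ofRel, ofRel_mul_ofRel fun _ _ _ _ h _ h' _ => h.left_unique h']
  refine ofRel_congr fun p p' => ⟨?_, ?_⟩
  · rintro ⟨q, h, h'⟩
    exact ⟨h.right_unique h', h.fst_right⟩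
  · rintro ⟨rfl, h⟩
    obtain ⟨q, h⟩ := Prepend.exists_of_fst_eq h
    exact ⟨q, h, h⟩

theorem ofRel_diagonal_mul {X : Type*} [Fintype X] (s : X → Prop) (r : X → X → Prop) :
    ofRel (fun x y => x = y ∧ s x) * ofRel r = ofRel fun x y => s x ∧ r x y := by
  rw [ofRel_mul_ofRel fun _ _ _ _ h _ h' _ => h.1.symm.trans h'.1]
  refine ofRel_congr fun x y => ⟨?_, ?_⟩
  · rintro ⟨_, ⟨rfl, h⟩, h'⟩
    exact ⟨h, h'⟩
  · rintro ⟨h, h'⟩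
    exact ⟨x, ⟨rfl, h⟩, h'⟩

/-- The Cuntz–Krieger family on the Hilbert space with basis the paths that end at the sink `a`. -/
def ofSink (ha : IsSink a) [Fintype (PathTo a)] [DecidableEq (PathTo a)] :
    CuntzKriegerFamily V (Matrix (PathTo a) (PathTo a) ℂ) where
  P b := ofRel fun q q' => q = q' ∧ q.1 = b
  S e := ofRel (Prepend e)
  isStarProjection_P b := by
    constructor
    · rw [IsIdempotentElem, ofRel_diagonal_mul]
      exact ofRel_congr fun q q' => ⟨fun h => h.2, fun h => ⟨h.2, h⟩⟩
    · rw [IsSelfAdjoint, star_ofRel]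
      exact ofRel_congr fun q q' =>
        ⟨fun h => ⟨h.1.symm, h.1 ▸ h.2⟩, fun h => ⟨h.1.symm, h.1 ▸ h.2⟩⟩
  P_mul_P b c h := by
    rw [ofRel_diagonal_mul]
    exact ofRel_eq_zero fun q q' h' => h (h'.1.symm.trans h'.2.2)
  S_mul_star_mul_S e := by
    rw [ofRel_prepend_mul_star, ofRel_diagonal_mul]
    exact ofRel_congr fun q p => ⟨fun h => h.2, fun h => ⟨⟨p, h⟩, h⟩⟩
  range_mul_range e f h := by
    rw [ofRel_prepend_mul_star, ofRel_prepend_mul_star, ofRel_diagonal_mul]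
    refine ofRel_eq_zero ?_
    rintro q q' ⟨⟨p, h1⟩, -, p', h2⟩
    exact h (h1.edge_unique h2)
  star_S_mul_S e := star_ofRel_prepend_mul e
  range_le e := by
    rw [ofRel_prepend_mul_star, ofRel_diagonal_mul]
    refine ofRel_congr fun q q' => ⟨fun h => h.2, fun h => ⟨?_, h⟩⟩
    obtain ⟨-, p, h⟩ := h
    exact h.fst_left
  P_eq_sum b hb hfin := by
    have := Fintype.ofFinite (Star b)
    rw [finsum_eq_sum_of_fintype]
    simp only [ofRel_prepend_mul_star]
    ext q q'
    rw [Matrix.sum_apply]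
    rw [ofRel_apply]
    split_ifs with h
    · obtain ⟨rfl, rfl⟩ := h
      -- As `q.1` emits an edge, it is not the sink, so `q` has a first edge; only that edge
      -- contributes to the sum.
      obtain ⟨e, p, h⟩ := Prepend.exists_of_ne (q := q) fun h => by
        rw [h] at hb
        exact (not_isEmpty_iff.2 hb) ha
      rw [Finset.sum_eq_single e, ofRel_of ⟨rfl, p, h⟩]
      · rintro ⟨d, f⟩ - hf
        refine ofRel_of_not ?_
        rintro ⟨-, p', h'⟩
        have := h.edge_unique h'
        obtain ⟨c, e⟩ := e
        cases this
        exact hf rfl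
      · exact fun h => (h (Finset.mem_univ _)).elim
    · refine (Finset.sum_eq_zero fun f _ => ofRel_of_not ?_).symm
      rintro ⟨h1, p', h2⟩
      exact h ⟨h1, h2.fst_left⟩

/-- `ofSink` as a representation. -/
def repOfSink (ha : IsSink a) [Fintype (PathTo a)] [DecidableEq (PathTo a)] :
    CuntzKriegerRep V where
  carrier := Matrix (PathTo a) (PathTo a) ℂ
  family := ofSink ha

/-- The representation of the graph C*-algebra on the paths that end at the sink `a`. -/
def sinkRep (ha : IsSink a) [Fintype (PathTo a)] [DecidableEq (PathTo a)] :
    GraphCStar V →⋆ₙₐ[ℂ] Matrix (PathTo a) (PathTo a) ℂ :=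
  GraphCStar.lift (repOfSink ha)

variable (ha : IsSink a) [Fintype (PathTo a)] [DecidableEq (PathTo a)]

theorem sinkRep_P (b : V) :
    sinkRep ha (GraphCStar.P b) = ofRel fun q q' => q = q' ∧ q.1 = b := rfl

theorem sinkRep_S (e : Total V) : sinkRep ha (GraphCStar.S e) = ofRel (Prepend e) := rfl

theorem sinkRep_one [Finite V] : sinkRep ha 1 = 1 := by
  have := Fintype.ofFinite V
  rw [GraphCStar.one_def, finsum_eq_sum_of_fintype, map_sum]
  simp only [sinkRep_P]
  ext q q'
  rw [Matrix.sum_apply, Matrix.one_apply]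
  split_ifs with hq
  · rw [Finset.sum_eq_single q.1, ofRel_of ⟨hq, rfl⟩]
    · exact fun b _ hb => ofRel_of_not fun h => hb h.2.symm
    · exact fun h => (h (Finset.mem_univ _)).elim
  · exact Finset.sum_eq_zero fun b _ => ofRel_of_not fun h => hq h.1

theorem circle_pow_mul_star (z : Circle) (n : ℕ) : (z : ℂ) ^ n * star ((z : ℂ) ^ n) = 1 := by
  rw [star_pow, ← mul_pow, RCLike.star_def, Complex.mul_conj, Complex.normSq_eq_norm_sq,
    Circle.norm_coe]
  simp

/-- The gauge action is implemented by the diagonal unitaries with entries `z ^ length`. -/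
theorem sinkRep_gauge_apply (z : Circle) (x : GraphCStar V) (q p : PathTo a) :
    sinkRep ha (GraphCStar.gauge V z x) q p =
      (z : ℂ) ^ q.2.length * sinkRep ha x q p * star ((z : ℂ) ^ p.2.length) := by
  let D : unitary (Matrix (PathTo a) (PathTo a) ℂ) :=
    ⟨Matrix.diagonal fun p => (z : ℂ) ^ p.2.length, by
      rw [Unitary.mem_iff, Matrix.star_eq_conjTranspose, Matrix.diagonal_conjTranspose,
        Matrix.diagonal_mul_diagonal, Matrix.diagonal_mul_diagonal, ← Matrix.diagonal_one]
      constructor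
      · congr 1
        funext p
        rw [Pi.star_apply, mul_comm, circle_pow_mul_star]
      · congr 1
        funext p
        rw [Pi.star_apply, circle_pow_mul_star]⟩
  have hD : ∀ (x : Matrix (PathTo a) (PathTo a) ℂ) q p,
      Unitary.conjStarAlgAut ℂ (Matrix (PathTo a) (PathTo a) ℂ) D x q p =
        (z : ℂ) ^ q.2.length * x q p * star ((z : ℂ) ^ p.2.length) := fun x q p => by
    have h1 : star D.1 = Matrix.diagonal (star fun p : PathTo a => (z : ℂ) ^ p.2.length) :=
      Matrix.diagonal_conjTranspose _
    rw [Unitary.conjStarAlgAut_apply]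
    refine (congrArg (fun M : Matrix (PathTo a) (PathTo a) ℂ => (D.1 * x * M) q p) h1).trans ?_
    rw [Matrix.mul_diagonal, Matrix.diagonal_mul]
    rfl
  -- Two homomorphisms are compared on generators: the `P b` are diagonal and the `S e` raise the
  -- length by one.
  have key : (sinkRep ha).comp (GraphCStar.gaugeHom z) =
      ((Unitary.conjStarAlgAut ℂ _ D : _ ≃⋆ₐ[ℂ] _) :
        Matrix (PathTo a) (PathTo a) ℂ →⋆ₙₐ[ℂ] Matrix (PathTo a) (PathTo a) ℂ).comp
        (sinkRep ha) := by
    refine GraphCStar.hom_ext (fun b => ?_) fun e => ?_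
    · ext q p
      refine Eq.trans ?_ (hD _ _ _).symm
      change sinkRep ha (GraphCStar.P b) q p = _ * sinkRep ha (GraphCStar.P b) q p * _
      rw [sinkRep_P, ofRel_apply]
      split_ifs with h
      · rw [h.1, mul_right_comm, circle_pow_mul_star, one_mul]
      · rw [mul_zero, zero_mul]
    · ext q p
      refine Eq.trans ?_ (hD _ _ _).symm
      change sinkRep ha ((z : ℂ) • GraphCStar.S e) q p = _ * sinkRep ha (GraphCStar.S e) q p * _
      rw [map_smul, Matrix.smul_apply, sinkRep_S, smul_eq_mul]
      by_cases h : Prepend e q p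
      · rw [h.length_eq, mul_right_comm, pow_succ', mul_assoc (z : ℂ), circle_pow_mul_star, mul_one]
      · rw [ofRel_of_not h, mul_zero, mul_zero, zero_mul]
  rw [← hD]
  exact congrFun (congrFun (DFunLike.congr_fun key x) q) p

end CuntzKriegerFamily

/-- Used for homomorphisms whose type does not record that they preserve the unit. -/
theorem IsUnit.map_of_map_one {A B F : Type*} [Monoid A] [Monoid B] [FunLike F A B]
    [MulHomClass F A B] (f : F) (h1 : f 1 = 1) {x : A} (hx : IsUnit x) : IsUnit (f x) :=
  hx.map ({ toFun := f, map_one' := h1, map_mul' := map_mul f } : A →* B)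

theorem exists_cyclicSubgroup_isPrimitiveRoot (k : ℕ) [NeZero k] :
    ∃ g : cyclicSubgroup k, IsPrimitiveRoot (g : Circle) k := by
  have h : IsPrimitiveRoot (Circle.exp (2 * Real.pi / k)) k := by
    refine IsPrimitiveRoot.of_map_of_injective (f := Circle.coeHom) ?_ Circle.coe_injective
    have h := Complex.isPrimitiveRoot_exp k (NeZero.ne k)
    convert h using 1
    change ((Circle.exp (2 * Real.pi / k) : Circle) : ℂ) = _
    rw [Circle.coe_exp]
    congr 1
    push_cast
    ring
  exact ⟨⟨_, h.pow_eq_one⟩, h⟩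

/-! ### Eigenvectors in the cone algebra -/

namespace ConeAlgebra

/-- The square root of `t`, multiplied by the `l`-th power of the standard character. -/
def sqrtChar (k l : ℕ) : ConeAlgebra (cyclicSubgroup k) where
  toFun p := (√(p.1 : ℝ) : ℂ) * ((p.2 : Circle) : ℂ) ^ l
  continuous_toFun := by fun_prop
  zero_at_infty' := by
    have h := (zero_at_infty (t (cyclicSubgroup k))).norm.sqrt
    rw [tendsto_zero_iff_norm_tendsto_zero]
    simp only [norm_zero, Real.sqrt_zero] at h
    refine h.congr fun p => ?_
    change √‖((p.1 : ℝ) : ℂ)‖ = _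
    rw [norm_mul, norm_pow, Circle.norm_coe, one_pow, mul_one, Complex.norm_real,
      Complex.norm_real, Real.norm_of_nonneg p.1.2.1.le, Real.norm_of_nonneg (Real.sqrt_nonneg _)]

theorem sqrtChar_apply (k l : ℕ) (s : Set.Ioc (0 : ℝ) 1) (h : cyclicSubgroup k) :
    sqrtChar k l (s, h) = (√(s : ℝ) : ℂ) * ((h : Circle) : ℂ) ^ l := rfl

theorem star_sqrtChar_mul (k l : ℕ) :
    star (sqrtChar k l) * sqrtChar k l = t (cyclicSubgroup k) := by
  ext ⟨s, h⟩
  have h1 : (√(s : ℝ) : ℂ) * (√(s : ℝ) : ℂ) = ((s : ℝ) : ℂ) := by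
    rw [← Complex.ofReal_mul, Real.mul_self_sqrt s.2.1.le]
  have h2 := CuntzKriegerFamily.circle_pow_mul_star h l
  have h3 : star (√(s : ℝ) : ℂ) = (√(s : ℝ) : ℂ) := Complex.conj_ofReal _
  change star (sqrtChar k l (s, h)) * sqrtChar k l (s, h) = ((s : ℝ) : ℂ)
  rw [sqrtChar_apply, star_mul, h3]
  linear_combination ((√(s : ℝ) : ℂ) * (√(s : ℝ) : ℂ)) * h2 + h1

theorem translate_sqrtChar (k l : ℕ) (g : cyclicSubgroup k) :
    translate g (sqrtChar k l) = (((g : Circle) : ℂ) ^ l) • sqrtChar k l := by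
  ext ⟨s, h⟩
  rw [translate_apply, ZeroAtInftyContinuousMap.smul_apply, sqrtChar_apply, sqrtChar_apply,
    Subgroup.coe_mul, Circle.coe_mul, mul_pow, smul_eq_mul]
  ring

end ConeAlgebra

/-! ### The lower bound by ranks -/

theorem Matrix.rank_add_le_rank_add_rank {m n : Type*} [Fintype n] [Fintype m] (M N : Matrix m n ℂ) :
    (M + N).rank ≤ M.rank + N.rank := by
  rw [Matrix.rank, Matrix.rank, Matrix.rank, Matrix.mulVecLin_add]
  refine (Submodule.finrank_mono (LinearMap.range_add_le _ _)).trans ?_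
  exact Submodule.finrank_add_le_finrank_add_finrank _ _

theorem Matrix.rank_sum_le {ι m n : Type*} [Fintype n] [Fintype m] (s : Finset ι)
    (M : ι → Matrix m n ℂ) (r : ℕ) (h : ∀ i ∈ s, (M i).rank ≤ r) :
    (∑ i ∈ s, M i).rank ≤ s.card * r := by
  classical
  induction s using Finset.induction_on with
  | empty => simp
  | insert i s hi ih =>
    rw [Finset.sum_insert hi, Finset.card_insert_of_notMem hi, add_mul, one_mul, add_comm]
    refine (Matrix.rank_add_le_rank_add_rank _ _).trans (add_le_add (ih fun j hj => ?_) ?_)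
    · exact h j (Finset.mem_insert_of_mem hj)
    · exact h i (Finset.mem_insert_self i s)

namespace CuntzKriegerFamily

open Quiver Matrix

variable {V : Type u} [Quiver.{v} V] {a : V} [Fintype (PathTo a)] [DecidableEq (PathTo a)] {k : ℕ}

/-- If the entry is nonzero, evaluating the action at a primitive root forces `|q| ≡ |p| + l` modulo
`k`. -/
theorem sinkRep_apply_eq_zero [NeZero k] (ha : IsSink a) {l : ℕ} {x : GraphCStar V}
    (hx : ∀ g : cyclicSubgroup k,
      GraphCStar.cyclicGauge V k g x = (((g : Circle) : ℂ) ^ l) • x)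
    {q p : PathTo a} (h : (q.2.length : ZMod k) ≠ p.2.length + l) : sinkRep ha x q p = 0 := by
  by_contra h0
  obtain ⟨g, hg⟩ := exists_cyclicSubgroup_isPrimitiveRoot k
  have h1 := sinkRep_gauge_apply ha g x q p
  have h2 : GraphCStar.gauge V g x = (((g : Circle) : ℂ) ^ l) • x := hx g
  rw [h2, map_smul, Matrix.smul_apply, smul_eq_mul, mul_right_comm] at h1
  have h3 := mul_right_cancel₀ h0 h1
  have h4 : ((g : Circle) : ℂ) ^ (l + p.2.length) = ((g : Circle) : ℂ) ^ q.2.length := by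
    rw [pow_add, h3, mul_assoc, mul_comm (star _), circle_pow_mul_star, mul_one]
  have h5 : (g : Circle) ^ (l + p.2.length) = (g : Circle) ^ q.2.length :=
    Circle.coe_injective (by simpa using h4)
  rw [pow_eq_pow_iff_modEq, ← hg.eq_orderOf, ← ZMod.natCast_eq_natCast_iff] at h5
  push_cast at h5
  rw [← h5, add_comm] at h
  exact h rfl

/-- The projection onto the span of the paths whose length is congruent to `j`. -/
def lengthProj (a : V) [DecidableEq (PathTo a)] (k : ℕ) (j : ZMod k) :
    Matrix (PathTo a) (PathTo a) ℂ :=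
  Matrix.diagonal fun p => if (p.2.length : ZMod k) = j then 1 else 0

theorem rank_lengthProj (j : ZMod k) : (lengthProj a k j).rank = pathCount a k j := by
  classical
  rw [lengthProj, rank_diagonal, pathCount, ← Nat.card_eq_fintype_card]
  exact Nat.card_congr (Equiv.subtypeEquivRight fun p => by simp)

theorem pathCount_le_of_weakLocalTriviality [NeZero k] [Finite V] (ha : IsSink a) (n : ℕ)
    (ρ : Fin (n + 1) → (ConeAlgebra (cyclicSubgroup k) →⋆ₙₐ[ℂ] GraphCStar V))
    (hρ : ∀ i g f, ρ i (ConeAlgebra.translate g f) = GraphCStar.cyclicGauge V k g (ρ i f))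
    (hu : IsUnit (∑ i, ρ i (ConeAlgebra.t (cyclicSubgroup k)))) (j j' : ZMod k) :
    pathCount a k j ≤ (n + 1) * pathCount a k j' := by
  -- With this degree, `B i` carries length class `j` to class `j'`.
  let l : ℕ := (j' - j).val
  let B : Fin (n + 1) → Matrix (PathTo a) (PathTo a) ℂ := fun i =>
    sinkRep ha (ρ i (ConeAlgebra.sqrtChar k l))
  have hB : ∀ i, B i * lengthProj a k j = lengthProj a k j' * B i := fun i => by
    ext q p
    rw [lengthProj, lengthProj, Matrix.mul_diagonal, Matrix.diagonal_mul]
    by_cases h : (q.2.length : ZMod k) = p.2.length + l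
    · have h1 : (q.2.length : ZMod k) = j' ↔ (p.2.length : ZMod k) = j := by
        rw [h, ZMod.natCast_zmod_val]
        exact ⟨fun h => by linear_combination h, fun h => by linear_combination h⟩
      simp only [h1]
      split_ifs <;> simp
    · have h0 : B i q p = 0 := by
        refine sinkRep_apply_eq_zero ha (fun g => ?_) h
        rw [← hρ, ConeAlgebra.translate_sqrtChar, map_smul]
      rw [h0, zero_mul, mul_zero]
  have hT := hu.map_of_map_one (sinkRep ha) (sinkRep_one ha)
  have hsum : sinkRep ha (∑ i, ρ i (ConeAlgebra.t (cyclicSubgroup k))) * lengthProj a k j =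
      ∑ i, star (B i) * (lengthProj a k j' * B i) := by
    rw [map_sum, Finset.sum_mul]
    refine Finset.sum_congr rfl fun i _ => ?_
    rw [← hB, ← ConeAlgebra.star_sqrtChar_mul k l, map_mul, map_mul, map_star, map_star, mul_assoc]
  -- Multiplication by the invertible sum keeps the rank, while each summand in `hsum` has rank at
  -- most that of `lengthProj a k j'`.
  have hrank := Matrix.rank_mul_eq_right_of_isUnit_det _ (lengthProj a k j)
    ((Matrix.isUnit_iff_isUnit_det _).1 hT)
  rw [← rank_lengthProj, ← hrank, hsum, ← rank_lengthProj]
  refine (Matrix.rank_sum_le _ _ _ fun i _ =>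
    (Matrix.rank_mul_le_right _ _).trans (Matrix.rank_mul_le_left _ _)).trans_eq ?_
  rw [Finset.card_univ, Fintype.card_fin]

end CuntzKriegerFamily

/-! ### Equivariant homomorphisms from projections -/

/-- A projection that is orthogonal to its translates under a finite group yields an equivariant
*-homomorphism on the cone algebra. -/
theorem ConeAlgebra.exists_equivariant_hom {G : Type w} [Group G] [TopologicalSpace G]
    [ContinuousMul G] [CompactSpace G] [Fintype G] {A : Type u} [CStarAlgebra A]
    (α : G →* (A ≃⋆ₐ[ℂ] A)) {q : A} (hq : IsStarProjection q)
    (hα : ∀ g ≠ 1, q * α g q = 0) :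
    ∃ ρ : ConeAlgebra G →⋆ₙₐ[ℂ] A,
      (∀ g f, ρ (ConeAlgebra.translate g f) = α g (ρ f)) ∧
        ρ (ConeAlgebra.t G) = ∑ g, α g q := by
  have hmul : ∀ g h, g ≠ h → α g⁻¹ q * α h⁻¹ q = 0 := fun g h hgh => by
    have h1 : α h⁻¹ q = α g⁻¹ (α (g * h⁻¹) q) := by
      rw [map_mul, map_inv, StarAlgEquiv.mul_apply, ← StarAlgEquiv.mul_apply, ← map_inv,
        ← map_mul, inv_mul_cancel, map_one, StarAlgEquiv.one_apply]
    rw [h1, ← map_mul, hα _ fun h2 => hgh (mul_inv_eq_one.1 h2), map_zero]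
  have hself : ∀ g, α g q * α g q = α g q := fun g => by
    rw [← map_mul, hq.isIdempotentElem]
  -- Evaluate at `1`, where `t` is `1`, and send the point mass at `h` to `α h⁻¹ q`; the inverse
  -- fits the action by right translation.
  let one : Set.Ioc (0 : ℝ) 1 := ⟨1, zero_lt_one, le_rfl⟩
  refine ⟨{ toFun := fun f => ∑ h, f (one, h) • α h⁻¹ q
            map_smul' := fun c f => ?_
            map_zero' := ?_
            map_add' := fun f f' => ?_
            map_mul' := fun f f' => ?_
            map_star' := fun f => ?_ }, fun g f => ?_, ?_⟩
  · simp only [ZeroAtInftyContinuousMap.smul_apply, smul_assoc, Finset.smul_sum,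
      MonoidHom.id_apply]
  · simp
  · change ∑ h, (f + f') (one, h) • α h⁻¹ q = ∑ h, f (one, h) • α h⁻¹ q + ∑ h, f' (one, h) • α h⁻¹ q
    simp only [ZeroAtInftyContinuousMap.add_apply, add_smul, Finset.sum_add_distrib]
  · change ∑ h, (f * f') (one, h) • α h⁻¹ q =
      (∑ h, f (one, h) • α h⁻¹ q) * ∑ h, f' (one, h) • α h⁻¹ q
    rw [Finset.sum_mul_sum]
    refine Finset.sum_congr rfl fun h _ => ?_
    rw [Finset.sum_eq_single h]
    · rw [smul_mul_smul_comm, hself]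
      rfl
    · intro h' _ hh
      rw [smul_mul_smul_comm, hmul _ _ hh.symm, smul_zero]
    · exact fun hh => (hh (Finset.mem_univ h)).elim
  · rw [star_sum]
    refine Finset.sum_congr rfl fun h _ => ?_
    have hs : star (α h⁻¹ q) = α h⁻¹ q := by rw [← map_star, hq.isSelfAdjoint.star_eq]
    rw [star_smul, hs]
    rfl
  · change ∑ h, f (one, h * g) • α h⁻¹ q = α g (∑ h, f (one, h) • α h⁻¹ q)
    rw [map_sum]
    refine Fintype.sum_equiv (Equiv.mulRight g) _ _ fun h => ?_
    rw [map_smul, Equiv.coe_mulRight, ← StarAlgEquiv.mul_apply, ← map_mul, mul_inv_rev,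
      mul_inv_cancel_left]
  · change ∑ h : G, (((1 : ℝ) : ℂ)) • α h⁻¹ q = _
    simp only [Complex.ofReal_one, one_smul]
    exact Equiv.sum_comp (Equiv.inv G) fun g => α g q

/-! ### Covers by subsets of equal size -/

/-- A finite set is the union of `n + 1` subsets of size `m` if its size is between `m` and
`(n + 1) * m`. -/
theorem exists_injective_cover {Y : Type*} [Finite Y] {m n : ℕ} (h1 : m ≤ Nat.card Y)
    (h2 : Nat.card Y ≤ (n + 1) * m) :
    ∃ φ : Fin (n + 1) → Fin m → Y, (∀ i, Function.Injective (φ i)) ∧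
      ∀ y, ∃ i l, φ i l = y := by
  obtain hN | hN := Nat.eq_zero_or_pos (Nat.card Y)
  · have : IsEmpty Y := (Nat.card_eq_zero.1 hN).resolve_right fun h => h.false
    obtain rfl : m = 0 := by omega
    exact ⟨fun _ l => l.elim0, fun _ l => l.elim0, fun y => isEmptyElim y⟩
  · obtain ⟨e⟩ : Nonempty (Y ≃ Fin (Nat.card Y)) := ⟨Finite.equivFin Y⟩
    -- Consecutive windows of length `m` on a cycle of length `Nat.card Y`: `h1` keeps a window from
    -- overlapping itself, `h2` lets the windows reach every point.
    refine ⟨fun i l => e.symm ⟨(i * m + l) % Nat.card Y, Nat.mod_lt _ hN⟩, fun i l l' h => ?_,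
      fun y => ?_⟩
    · have h3 : (i * m + l) % Nat.card Y = (i * m + l') % Nat.card Y := by simpa using h
      have h4 := Nat.ModEq.add_left_cancel' (i * m) h3
      exact Fin.ext (Nat.ModEq.eq_of_lt_of_lt h4 (l.2.trans_le h1) (l'.2.trans_le h1))
    · have hy : (e y : ℕ) < (n + 1) * m := (e y).2.trans_le h2
      have hm : 0 < m := Nat.pos_of_ne_zero fun h => by simp [h] at hy
      refine ⟨⟨e y / m, (Nat.div_lt_iff_lt_mul hm).2 hy⟩, ⟨e y % m, Nat.mod_lt _ hm⟩, ?_⟩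
      rw [Equiv.symm_apply_eq]
      refine Fin.ext ?_
      change ((e y : ℕ) / m * m + (e y : ℕ) % m) % Nat.card Y = e y
      rw [Nat.div_add_mod', Nat.mod_eq_of_lt (e y).2]

/-! ### Characters of the cyclic group -/

instance (k : ℕ) [NeZero k] : Finite (cyclicSubgroup k) :=
  Finite.of_injective
    (fun g : cyclicSubgroup k => rootsOfUnity.mkOfPowEq ((g : Circle) : ℂ)
      (show ((g : Circle) : ℂ) ^ k = 1 by
        rw [← Circle.coe_pow, show (g : Circle) ^ k = 1 from g.2, Circle.coe_one]))
    fun g h hgh => Subtype.ext (Circle.coe_injective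
      (congrArg (fun x : rootsOfUnity k ℂ => ((x : ℂˣ) : ℂ)) hgh))

theorem cyclicSubgroup_pow_congr {k : ℕ} (g : cyclicSubgroup k) {m n : ℕ}
    (h : (m : ZMod k) = n) : ((g : Circle) : ℂ) ^ m = ((g : Circle) : ℂ) ^ n := by
  have hg : (g : Circle) ^ k = 1 := g.2
  have h1 : (g : Circle) ^ m = (g : Circle) ^ n :=
    pow_eq_pow_iff_modEq.2
      (((ZMod.natCast_eq_natCast_iff _ _ _).1 h).of_dvd (orderOf_dvd_of_pow_eq_one hg))
  rw [← Circle.coe_pow, h1, Circle.coe_pow]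

/-- The orthogonality relation for characters of the cyclic group. -/
theorem sum_cyclicSubgroup_pow_mul_star {k : ℕ} [NeZero k] [Fintype (cyclicSubgroup k)] {m n : ℕ}
    (h : (m : ZMod k) ≠ n) :
    ∑ g : cyclicSubgroup k, ((g : Circle) : ℂ) ^ m * star (((g : Circle) : ℂ) ^ n) = 0 := by
  obtain ⟨z, hz⟩ := exists_cyclicSubgroup_isPrimitiveRoot k
  set s := ∑ g : cyclicSubgroup k, ((g : Circle) : ℂ) ^ m * star (((g : Circle) : ℂ) ^ n) with hs
  -- Translating the summation variable by a primitive root scales the sum; a nonzero sum would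
  -- force `m ≡ n`.
  have h1 : s = ((z : Circle) : ℂ) ^ m * star (((z : Circle) : ℂ) ^ n) * s := by
    rw [hs, Finset.mul_sum, ← Equiv.sum_comp (Equiv.mulLeft z)]
    refine Finset.sum_congr rfl fun g _ => ?_
    rw [Equiv.coe_mulLeft, Subgroup.coe_mul, Circle.coe_mul, mul_pow, mul_pow, star_mul]
    ring
  by_contra hs0
  have h2 : ((z : Circle) : ℂ) ^ m * star (((z : Circle) : ℂ) ^ n) = 1 :=
    mul_right_cancel₀ hs0 (by rw [← h1, one_mul])
  have h3 : ((z : Circle) : ℂ) ^ m = ((z : Circle) : ℂ) ^ n := by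
    have h4 := CuntzKriegerFamily.circle_pow_mul_star z n
    linear_combination ((z : Circle) : ℂ) ^ n * h2 - ((z : Circle) : ℂ) ^ m * h4
  have h5 : (z : Circle) ^ m = (z : Circle) ^ n := Circle.coe_injective (by simpa using h3)
  rw [pow_eq_pow_iff_modEq, ← hz.eq_orderOf, ← ZMod.natCast_eq_natCast_iff] at h5
  exact h h5

/-! ### Homomorphisms from matrix units -/

section MatrixUnits

variable {ι : Type*} [Fintype ι] {X : ι → Type*} [∀ i, Fintype (X i)] {B : Type*}
  [NonUnitalCStarAlgebra B]

/-- The *-homomorphism that maps the matrix unit with index `p`, `q` in the block `i` to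
`s i p * star (s i q)`. -/
def matrixUnitsHom (s : ∀ i, X i → B) (P : ι → B)
    (hself : ∀ i p, star (s i p) * s i p = P i) (hP : ∀ i p, s i p * P i = s i p)
    (hne : ∀ i p j q, (⟨i, p⟩ : Sigma X) ≠ ⟨j, q⟩ → star (s i p) * s j q = 0) :
    (∀ i, Matrix (X i) (X i) ℂ) →⋆ₙₐ[ℂ] B where
  toFun x := ∑ i, ∑ p, ∑ q, x i p q • (s i p * star (s i q))
  map_smul' c x := by
    simp only [Pi.smul_apply, Matrix.smul_apply, smul_assoc, Finset.smul_sum, MonoidHom.id_apply]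
  map_zero' := by simp
  map_add' x y := by
    simp only [Pi.add_apply, Matrix.add_apply, add_smul, Finset.sum_add_distrib]
  map_mul' x y := by
    classical
    -- Orthogonality of the ranges leaves only row `r` of block `i`.
    have key : ∀ i r, star (s i r) * ∑ j, ∑ p, ∑ q, y j p q • (s j p * star (s j q)) =
        ∑ q, y i r q • star (s i q) := fun i r => by
      rw [Finset.mul_sum, Finset.sum_eq_single i, Finset.mul_sum, Finset.sum_eq_single r,
        Finset.mul_sum]
      · refine Finset.sum_congr rfl fun q _ => ?_
        have h1 : P i * star (s i q) = star (s i q) := by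
          have h2 : star (P i) = P i := by rw [← hself i q, star_mul, star_star]
          rw [← h2, ← star_mul, hP]
        rw [mul_smul_comm, ← mul_assoc, hself, h1]
      · intro p _ hp
        rw [Finset.mul_sum]
        refine Finset.sum_eq_zero fun q _ => ?_
        rw [mul_smul_comm, ← mul_assoc, hne, zero_mul, smul_zero]
        intro h
        cases h
        exact hp rfl
      · exact fun h => (h (Finset.mem_univ _)).elim
      · intro j _ hj
        rw [Finset.mul_sum]
        refine Finset.sum_eq_zero fun p _ => ?_
        rw [Finset.mul_sum]
        refine Finset.sum_eq_zero fun q _ => ?_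
        rw [mul_smul_comm, ← mul_assoc, hne, zero_mul, smul_zero]
        intro h
        cases h
        exact hj rfl
      · exact fun h => (h (Finset.mem_univ _)).elim
    rw [Finset.sum_mul]
    refine Finset.sum_congr rfl fun i _ => ?_
    rw [Finset.sum_mul]
    refine Finset.sum_congr rfl fun p _ => ?_
    rw [Finset.sum_mul]
    have hr : ∀ r, x i p r • (s i p * star (s i r)) *
        (∑ j, ∑ p, ∑ q, y j p q • (s j p * star (s j q))) =
        ∑ q, (x i p r * y i r q) • (s i p * star (s i q)) := fun r => by
      rw [smul_mul_assoc, mul_assoc, key, Finset.mul_sum, Finset.smul_sum]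
      simp only [mul_smul_comm, smul_smul]
    rw [Finset.sum_congr rfl fun r _ => hr r, Finset.sum_comm]
    refine Finset.sum_congr rfl fun q _ => ?_
    rw [Pi.mul_apply, Matrix.mul_apply, Finset.sum_smul]
  map_star' x := by
    simp only [star_sum, star_smul, star_mul, star_star, Pi.star_apply, Matrix.star_apply]
    exact Finset.sum_congr rfl fun i _ => Finset.sum_comm

end MatrixUnits

/-! ### From matrix algebras to the graph C*-algebra -/

namespace GraphCStar

open Quiver CuntzKriegerFamily

variable {V : Type u} [Quiver.{v} V]

theorem gauge_ofPath (z : Circle) {a b : V} (p : Path a b) :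
    gauge V z ((family V).ofPath p) = ((z : ℂ) ^ p.length) • (family V).ofPath p := by
  induction p with
  | nil => rw [ofPath, Path.length_nil, pow_zero, one_smul]; exact gauge_P z a
  | @cons b c p e ih =>
    have h : gauge V z ((family V).S ⟨b, c, e⟩) = (z : ℂ) • (family V).S ⟨b, c, e⟩ := gauge_S z _
    rw [ofPath_cons, map_mul, ih, h, smul_mul_smul_comm, Path.length_cons, pow_succ]

variable [Finite V] [Fintype {a : V // IsSink a}] [∀ a : V, Fintype (PathTo a)]

variable (V) in
/-- The *-homomorphism from the sum of the matrix algebras of all sinks to the graph C*-algebra. -/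
def sinkHom : (∀ a : {a : V // IsSink a}, Matrix (PathTo a.1) (PathTo a.1) ℂ) →⋆ₙₐ[ℂ]
    GraphCStar V :=
  matrixUnitsHom (fun _ p => (family V).ofPath p.2) (fun a => (family V).P a.1)
    (fun _ p => (family V).star_ofPath_mul_self p.2) (fun _ p => (family V).ofPath_mul_P p.2)
    fun a p b q h => (family V).star_ofPath_mul_of_ne a.2 p.2 b.2 q.2 fun h' => h <| by
      obtain ⟨a, ha⟩ := a
      obtain ⟨b, hb⟩ := b
      obtain ⟨c, p⟩ := p
      obtain ⟨d, q⟩ := q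
      cases h'
      rfl

theorem sinkHom_apply (x : ∀ a : {a : V // IsSink a}, Matrix (PathTo a.1) (PathTo a.1) ℂ) :
    sinkHom V x = ∑ a, ∑ p, ∑ q,
      x a p q • ((family V).ofPath p.2 * star ((family V).ofPath q.2)) := rfl

theorem gauge_sinkHom [∀ a : V, DecidableEq (PathTo a)] (z : Circle)
    (x : ∀ a : {a : V // IsSink a}, Matrix (PathTo a.1) (PathTo a.1) ℂ) :
    gauge V z (sinkHom V x) = sinkHom V fun a =>
      Matrix.diagonal (fun p => (z : ℂ) ^ p.2.length) * x a *
        star (Matrix.diagonal fun p => (z : ℂ) ^ p.2.length) := by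
  simp only [sinkHom_apply, map_sum]
  refine Finset.sum_congr rfl fun a _ => Finset.sum_congr rfl fun p _ =>
    Finset.sum_congr rfl fun q _ => ?_
  rw [map_smul, map_mul, map_star, gauge_ofPath, gauge_ofPath, star_smul, smul_mul_smul_comm,
    smul_smul, Matrix.star_eq_conjTranspose, Matrix.diagonal_conjTranspose, Matrix.mul_diagonal,
    Matrix.diagonal_mul, Pi.star_apply]
  congr 1
  ring

/-- The image of `1` is the sum of the range projections of all paths to sinks. It is a left unit
for every path product: clear if the path ends at a sink; otherwise split the projection of its
endpoint over the outgoing edges and induct from the sinks. Trivial paths then give the claim. -/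
theorem sinkHom_one [∀ a : V, DecidableEq (PathTo a)] [Finite (Total V)] (hV : Acyclic V) :
    sinkHom V 1 = 1 := by
  classical
  have := Fintype.ofFinite V
  have hy : sinkHom V 1 = ∑ a : {a : V // IsSink a}, ∑ p : PathTo a.1,
      (family V).ofPath p.2 * star ((family V).ofPath p.2) := by
    rw [sinkHom_apply]
    refine Finset.sum_congr rfl fun a _ => Finset.sum_congr rfl fun p _ => ?_
    rw [Finset.sum_eq_single p, Pi.one_apply, Matrix.one_apply_eq, one_smul]
    · intro q _ hq
      rw [Pi.one_apply, Matrix.one_apply_ne hq.symm, zero_smul]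
    · exact fun h => (h (Finset.mem_univ _)).elim
  have key : ∀ (b a : V) (p : Path a b),
      sinkHom V 1 * (family V).ofPath p = (family V).ofPath p := by
    intro b
    induction b using hV.wellFounded_swap.induction with
    | _ b ih =>
      intro a p
      by_cases hb : IsSink b
      · rw [hy, Finset.sum_mul, Finset.sum_eq_single ⟨b, hb⟩, Finset.sum_mul,
          Finset.sum_eq_single ⟨a, p⟩, mul_assoc, star_ofPath_mul_self, ofPath_mul_P]
        · intro q _ hq
          rw [mul_assoc, (family V).star_ofPath_mul_of_ne hb q.2 hb p, mul_zero]
          intro h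
          cases h
          exact hq rfl
        · exact fun h => (h (Finset.mem_univ _)).elim
        · intro c _ hc
          rw [Finset.sum_mul]
          refine Finset.sum_eq_zero fun q _ => ?_
          rw [mul_assoc, (family V).star_ofPath_mul_of_ne c.2 q.2 hb p, mul_zero]
          intro h
          refine hc (Subtype.ext ?_)
          exact congrArg Sigma.fst h
        · exact fun h => (h (Finset.mem_univ _)).elim
      · have hb' : Nonempty (Star b) := not_isEmpty_iff.1 hb
        have hfin : Finite (Star b) :=
          Finite.of_injective (fun e : Star b => (⟨b, e.1, e.2⟩ : Total V))
            fun ⟨_, _⟩ ⟨_, _⟩ h => by cases h; rfl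
        have := Fintype.ofFinite (Star b)
        have h1 := (family V).P_eq_sum b hb' hfin
        rw [finsum_eq_sum_of_fintype] at h1
        rw [← ofPath_mul_P, h1, Finset.mul_sum, Finset.mul_sum]
        refine Finset.sum_congr rfl fun e _ => ?_
        have h2 := ih e.1 ⟨e.2⟩ a (p.cons e.2)
        rw [ofPath_cons] at h2
        rw [← mul_assoc ((family V).ofPath p), ← mul_assoc (sinkHom V 1), h2]
  have h1 : sinkHom V 1 * 1 = 1 := by
    rw [one_def, finsum_eq_sum_of_fintype, Finset.mul_sum]
    exact Finset.sum_congr rfl fun a _ => key a a Path.nil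
  rwa [mul_one] at h1

end GraphCStar

/-! ### Projections orthogonal to their translates -/

section Orbits

open Matrix

variable {X : Type*} [DecidableEq X] {k : ℕ} (len : X → ℕ)

/-- The diagonal unitary with entries `g ^ len x`. -/
def lengthUnitary (g : cyclicSubgroup k) : Matrix X X ℂ :=
  Matrix.diagonal fun x => ((g : Circle) : ℂ) ^ len x

variable {len} {m : ℕ} {φ : ZMod k → Fin m → X}

/-- The columns are the indicator functions of the sets `{φ j l | j}`. -/
def orbitMatrix (len : X → ℕ) (φ : ZMod k → Fin m → X) : Matrix X (Fin m) ℂ :=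
  Matrix.of fun x l => if φ (len x) l = x then 1 else 0

theorem orbitMatrix_apply (x : X) (l : Fin m) :
    orbitMatrix len φ x l = if φ (len x) l = x then 1 else 0 := rfl

theorem star_orbitMatrix_apply (x : X) (l : Fin m) :
    star (orbitMatrix len φ x l) = orbitMatrix len φ x l := by
  rw [orbitMatrix_apply]
  split_ifs <;> simp

theorem orbitMatrix_mul_orbitMatrix_eq_zero (hinj : ∀ j, Function.Injective (φ j)) (x : X)
    {l l' : Fin m} (h : l ≠ l') : orbitMatrix len φ x l * orbitMatrix len φ x l' = 0 := by
  rw [orbitMatrix_apply, orbitMatrix_apply]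
  split_ifs with h1 h2
  · exact (h (hinj _ (h1.trans h2.symm))).elim
  all_goals simp

theorem orbitMatrix_mul_self (x : X) (l : Fin m) :
    orbitMatrix len φ x l * orbitMatrix len φ x l = orbitMatrix len φ x l := by
  rw [orbitMatrix_apply]
  split_ifs <;> simp

variable [Fintype X] [NeZero k]

theorem sum_mul_orbitMatrix (hφ : ∀ j l, (len (φ j l) : ZMod k) = j) (f : X → ℂ) (l : Fin m) :
    ∑ x, f x * orbitMatrix len φ x l = ∑ j, f (φ j l) := by
  refine (Finset.sum_of_injOn (fun j => φ j l) ?_ ?_ ?_ ?_).symm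
  · intro j _ j' _ h
    rw [← hφ j l, ← hφ j' l]
    exact congrArg (fun x => (len x : ZMod k)) h
  · exact fun _ _ => Finset.mem_coe.2 (Finset.mem_univ _)
  · intro x _ hx
    rw [orbitMatrix_apply, if_neg, mul_zero]
    exact fun h => hx ⟨_, Finset.mem_coe.2 (Finset.mem_univ _), h⟩
  · intro j _
    rw [orbitMatrix_apply, hφ, if_pos rfl, mul_one]

/-- The columns have disjoint supports with one point per residue. The weight `f = 1` gives the
norms, and `f = g ^ len` the inner products with the translates. -/
theorem conjTranspose_orbitMatrix_mul (hφ : ∀ j l, (len (φ j l) : ZMod k) = j)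
    (hinj : ∀ j, Function.Injective (φ j)) (f : X → ℂ) :
    (orbitMatrix len φ)ᴴ * (Matrix.diagonal f * orbitMatrix len φ) =
      Matrix.diagonal fun l => ∑ j, f (φ j l) := by
  ext l l'
  rw [Matrix.mul_apply]
  simp only [Matrix.conjTranspose_apply, Matrix.diagonal_mul, star_orbitMatrix_apply]
  by_cases h : l = l'
  · subst h
    rw [Matrix.diagonal_apply_eq, ← sum_mul_orbitMatrix hφ]
    refine Finset.sum_congr rfl fun x _ => ?_
    rw [mul_left_comm, orbitMatrix_mul_self]
  · rw [Matrix.diagonal_apply_ne _ h]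
    refine Finset.sum_eq_zero fun x _ => ?_
    rw [mul_left_comm, orbitMatrix_mul_orbitMatrix_eq_zero hinj x h, mul_zero]

/-- The projection onto the span of the columns of `orbitMatrix`. -/
def orbitProj (len : X → ℕ) (φ : ZMod k → Fin m → X) : Matrix X X ℂ :=
  (k : ℂ)⁻¹ • (orbitMatrix len φ * (orbitMatrix len φ)ᴴ)

theorem isStarProjection_orbitProj (hφ : ∀ j l, (len (φ j l) : ZMod k) = j)
    (hinj : ∀ j, Function.Injective (φ j)) : IsStarProjection (orbitProj len φ) := by
  have hk : (k : ℂ) ≠ 0 := Nat.cast_ne_zero.2 (NeZero.ne k)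
  have h1 : (orbitMatrix len φ)ᴴ * orbitMatrix len φ = (k : ℂ) • 1 := by
    have h := conjTranspose_orbitMatrix_mul hφ hinj fun _ => 1
    rw [Matrix.diagonal_one, Matrix.one_mul] at h
    rw [h, Matrix.smul_one_eq_diagonal]
    simp
  constructor
  · rw [IsIdempotentElem, orbitProj, smul_mul_smul_comm, Matrix.mul_assoc,
      ← Matrix.mul_assoc (orbitMatrix len φ)ᴴ, h1, Matrix.smul_mul, Matrix.one_mul,
      Matrix.mul_smul, smul_smul, mul_assoc, inv_mul_cancel₀ hk, mul_one]
  · rw [IsSelfAdjoint, orbitProj, star_smul, Matrix.star_eq_conjTranspose,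
      Matrix.conjTranspose_mul, Matrix.conjTranspose_conjTranspose]
    simp

theorem orbitProj_mul_conj (hφ : ∀ j l, (len (φ j l) : ZMod k) = j)
    (hinj : ∀ j, Function.Injective (φ j)) {g : cyclicSubgroup k} (hg : g ≠ 1) :
    orbitProj len φ * (lengthUnitary len g * orbitProj len φ * star (lengthUnitary len g)) = 0 := by
  have h1 : (orbitMatrix len φ)ᴴ * (lengthUnitary len g * orbitMatrix len φ) = 0 := by
    rw [lengthUnitary, conjTranspose_orbitMatrix_mul hφ hinj, ← Matrix.diagonal_zero]
    congr 1
    funext l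
    set s := ∑ j, ((g : Circle) : ℂ) ^ len (φ j l) with hs
    -- Multiplication by `g` shifts the residue by one and permutes the terms, so `s = 0` unless `g
    -- = 1`.
    have h2 : ((g : Circle) : ℂ) * s = s := by
      rw [hs, Finset.mul_sum]
      refine Fintype.sum_equiv (Equiv.addRight 1) _ _ fun j => ?_
      rw [← pow_succ', Equiv.coe_addRight]
      exact cyclicSubgroup_pow_congr g (by rw [Nat.cast_succ, hφ, hφ])
    by_contra hs0
    refine hg (Subtype.ext (Circle.coe_injective ?_))
    exact mul_right_cancel₀ hs0 (h2.trans (one_mul s).symm)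
  have h2 : ∀ Z : Matrix (Fin m) X ℂ,
      (orbitMatrix len φ)ᴴ * (lengthUnitary len g * (orbitMatrix len φ * Z)) = 0 := fun Z => by
    rw [← Matrix.mul_assoc (lengthUnitary len g), ← Matrix.mul_assoc, h1, Matrix.zero_mul]
  simp only [orbitProj, Matrix.mul_smul, Matrix.smul_mul, Matrix.mul_assoc, h2, Matrix.mul_zero,
    smul_zero]

/-- Character orthogonality removes the entries between different residues; within one residue, a
column contains only one point, so only the diagonal remains. -/
theorem sum_conj_orbitProj [Fintype (cyclicSubgroup k)] :
    ∑ g : cyclicSubgroup k, lengthUnitary len g * orbitProj len φ * star (lengthUnitary len g) =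
      Matrix.diagonal fun x => (Fintype.card (cyclicSubgroup k) * (k : ℂ)⁻¹) *
        ∑ l, orbitMatrix len φ x l := by
  ext x y
  have h0 : ∀ g : cyclicSubgroup k,
      (lengthUnitary len g * orbitProj len φ * star (lengthUnitary len g)) x y =
        ((g : Circle) : ℂ) ^ len x * star (((g : Circle) : ℂ) ^ len y) * orbitProj len φ x y :=
    fun g => by
      rw [lengthUnitary, Matrix.star_eq_conjTranspose, Matrix.diagonal_conjTranspose,
        Matrix.mul_diagonal, Matrix.diagonal_mul, Pi.star_apply]
      ring
  have h1 : orbitProj len φ x y =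
      (k : ℂ)⁻¹ * ∑ l, orbitMatrix len φ x l * orbitMatrix len φ y l := by
    rw [orbitProj, Matrix.smul_apply, Matrix.mul_apply, smul_eq_mul]
    simp only [Matrix.conjTranspose_apply, star_orbitMatrix_apply]
  rw [Matrix.sum_apply]
  simp only [h0, ← Finset.sum_mul]
  by_cases hxy : x = y
  · subst hxy
    rw [Matrix.diagonal_apply_eq, h1]
    simp only [orbitMatrix_mul_self, CuntzKriegerFamily.circle_pow_mul_star, Finset.sum_const,
      Finset.card_univ, nsmul_eq_mul, mul_one]
    ring
  · rw [Matrix.diagonal_apply_ne _ hxy]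
    by_cases hl : (len x : ZMod k) = len y
    · rw [h1, Finset.sum_eq_zero (s := Finset.univ (α := Fin m)), mul_zero, mul_zero]
      intro l _
      rw [orbitMatrix_apply, orbitMatrix_apply, hl]
      split_ifs with h2 h3
      · exact (hxy (h2.symm.trans h3)).elim
      all_goals simp
    · rw [sum_cyclicSubgroup_pow_mul_star hl, zero_mul]

/-- If the fibres of the length modulo `k` have comparable sizes, then there are `n + 1` projections,
orthogonal to their translates, whose translates sum up to an invertible matrix. -/
theorem exists_projections [Fintype (cyclicSubgroup k)] (len : X → ℕ) (n : ℕ)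
    (h : ∀ j j' : ZMod k, Nat.card {x // (len x : ZMod k) = j} ≤
      (n + 1) * Nat.card {x // (len x : ZMod k) = j'}) :
    ∃ q : Fin (n + 1) → Matrix X X ℂ, (∀ i, IsStarProjection (q i)) ∧
      (∀ i, ∀ g : cyclicSubgroup k, g ≠ 1 →
        q i * (lengthUnitary len g * q i * star (lengthUnitary len g)) = 0) ∧
      IsUnit (∑ i, ∑ g : cyclicSubgroup k,
        lengthUnitary len g * q i * star (lengthUnitary len g)) := by
  -- The smallest class supplies a common `m`, so that the chosen subsets of different classes can
  -- be matched index by index.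
  obtain ⟨j₀, hj₀⟩ := Finite.exists_min fun j : ZMod k => Nat.card {x // (len x : ZMod k) = j}
  choose φ hφ1 hφ2 using fun j : ZMod k => exists_injective_cover (hj₀ j) (h j j₀)
  let ψ : ∀ _ : Fin (n + 1), ZMod k → Fin _ → X := fun i j l => (φ j i l).1
  have hψ : ∀ i j l, (len (ψ i j l) : ZMod k) = j := fun i j l => (φ j i l).2
  have hinj : ∀ i j, Function.Injective (ψ i j) := fun i j =>
    Subtype.val_injective.comp (hφ1 j i)
  refine ⟨fun i => orbitProj len (ψ i), fun i => isStarProjection_orbitProj (hψ i) (hinj i),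
    fun i g hg => orbitProj_mul_conj (hψ i) (hinj i) hg, ?_⟩
  simp only [sum_conj_orbitProj]
  let w : Fin (n + 1) → X → ℂ := fun i x => (Fintype.card (cyclicSubgroup k) * (k : ℂ)⁻¹) *
    ∑ l, orbitMatrix len (ψ i) x l
  have hw : ∑ i, Matrix.diagonal (w i) = Matrix.diagonal (∑ i, w i) :=
    (map_sum (Matrix.diagonalAddMonoidHom X ℂ) w Finset.univ).symm
  refine (congrArg IsUnit hw).mpr ?_
  rw [Matrix.isUnit_diagonal, Pi.isUnit_iff]
  intro x
  rw [isUnit_iff_ne_zero, Finset.sum_apply, ← Finset.mul_sum]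
  refine mul_ne_zero (mul_ne_zero (Nat.cast_ne_zero.2 Fintype.card_ne_zero)
    (inv_ne_zero (Nat.cast_ne_zero.2 (NeZero.ne k)))) ?_
  -- Over the natural numbers nothing cancels: one transversal through `x` makes the entry nonzero.
  have h1 : ∑ i, ∑ l, orbitMatrix len (ψ i) x l =
      ((∑ i, ∑ l, if ψ i (len x) l = x then 1 else 0 : ℕ) : ℂ) := by
    push_cast
    rfl
  rw [h1, Nat.cast_ne_zero]
  obtain ⟨i, l, hil⟩ := hφ2 (len x) ⟨x, rfl⟩
  have hil' : ψ i (len x) l = x := congrArg Subtype.val hil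
  intro h0
  have h3 := Finset.sum_eq_zero_iff.1 (Finset.sum_eq_zero_iff.1 h0 i (Finset.mem_univ i)) l
    (Finset.mem_univ l)
  rw [if_pos hil'] at h3
  exact one_ne_zero h3

end Orbits
end

/-! ### Both bounds combined -/

-- The projections are chosen in the matrix block of each sink, for a common `n`, and carried over
-- by the equivariant unital `sinkHom`.
open Quiver in
theorem GraphCStar.exists_weakLocalTriviality {V : Type u} [Quiver.{v} V] [Finite V]
    [Finite (Total V)] (hV : Acyclic V) (k : ℕ) [NeZero k] (n : ℕ)
    (h : ∀ a : V, IsSink a → ∀ j j' : ZMod k,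
      pathCount a k j ≤ (n + 1) * pathCount a k j') :
    ∃ ρ : Fin (n + 1) → (ConeAlgebra (cyclicSubgroup k) →⋆ₙₐ[ℂ] GraphCStar V),
      (∀ i g f, ρ i (ConeAlgebra.translate g f) = GraphCStar.cyclicGauge V k g (ρ i f)) ∧
        IsUnit (∑ i, ρ i (ConeAlgebra.t (cyclicSubgroup k))) := by
  classical
  have := fun a : V => hV.finite_pathTo a
  have := fun a : V => Fintype.ofFinite (PathTo a)
  have := Fintype.ofFinite {a : V // IsSink a}
  have := Fintype.ofFinite (cyclicSubgroup k)
  choose q hq1 hq2 hq3 using fun a : {a : V // IsSink a} =>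
    exists_projections (fun p : PathTo a.1 => p.2.length) n (h a.1 a.2)
  have hα : ∀ (g : cyclicSubgroup k) i,
      GraphCStar.cyclicGauge V k g (sinkHom V fun a => q a i) =
        sinkHom V fun a => lengthUnitary (fun p : PathTo a.1 => p.2.length) g * q a i *
          star (lengthUnitary (fun p : PathTo a.1 => p.2.length) g) :=
    fun g i => gauge_sinkHom g _
  choose ρ hρ1 hρ2 using fun i => ConeAlgebra.exists_equivariant_hom (cyclicGauge V k)
    (q := sinkHom V fun a => q a i)
    ⟨by
      rw [IsIdempotentElem, ← map_mul]
      exact congrArg _ (funext fun a => (hq1 a i).isIdempotentElem),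
    by
      rw [IsSelfAdjoint, ← map_star]
      exact congrArg _ (funext fun a => (hq1 a i).isSelfAdjoint)⟩
    fun g hg => by
      rw [hα, ← map_mul, ← map_zero (sinkHom V)]
      exact congrArg _ (funext fun a => hq2 a i g hg)
  refine ⟨ρ, hρ1, ?_⟩
  have hsum : ∑ i, ρ i (ConeAlgebra.t (cyclicSubgroup k)) =
      sinkHom V (∑ i, ∑ g : cyclicSubgroup k, fun a =>
        lengthUnitary (fun p : PathTo a.1 => p.2.length) g * q a i *
          star (lengthUnitary (fun p : PathTo a.1 => p.2.length) g)) := by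
    rw [map_sum]
    refine Finset.sum_congr rfl fun i _ => ?_
    rw [hρ2, map_sum]
    exact Finset.sum_congr rfl fun g _ => hα g i
  refine (congrArg IsUnit hsum).mpr ?_
  refine IsUnit.map_of_map_one (sinkHom V) (sinkHom_one hV) (Pi.isUnit_iff.2 fun a => ?_)
  simp only [Finset.sum_apply]
  exact hq3 a

theorem Quiver.quot_le_iff {V : Type u} [Quiver.{v} V] (a : V) (k : ℕ) [NeZero k]
    [Finite (PathTo a)] (n : ℕ) :
    Quiver.quot a k ≤ (n : ℕ∞) + 1 ↔
      ∀ j j' : ZMod k, pathCount a k j ≤ (n + 1) * pathCount a k j' := by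
  obtain ⟨i, -, hi⟩ := Finset.exists_mem_eq_sup' Finset.univ_nonempty (pathCount a k)
  obtain ⟨i', -, hi'⟩ := Finset.exists_mem_eq_inf' Finset.univ_nonempty (pathCount a k)
  have h1 : (∀ j j' : ZMod k, pathCount a k j ≤ (n + 1) * pathCount a k j') ↔
      pathCount a k i ≤ (n + 1) * pathCount a k i' := by
    refine ⟨fun h => h i i', fun h j j' => ?_⟩
    have h2 : pathCount a k j ≤ pathCount a k i :=
      hi ▸ Finset.le_sup' (pathCount a k) (Finset.mem_univ j)
    have h3 : pathCount a k i' ≤ pathCount a k j' :=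
      hi' ▸ Finset.inf'_le (pathCount a k) (Finset.mem_univ j')
    exact h2.trans (h.trans (Nat.mul_le_mul_left _ h3))
  -- The trivial path makes the maximum positive, so a zero minimum violates the inequalities, in
  -- accordance with the value `⊤`.
  have hpos : 0 < pathCount a k i := by
    refine lt_of_lt_of_le ?_
      (hi ▸ Finset.le_sup' (pathCount a k) (Finset.mem_univ (0 : ZMod k)))
    exact Nat.card_pos_iff.2 ⟨⟨⟨⟨a, Path.nil⟩, Nat.cast_zero⟩⟩, inferInstance⟩
  rw [h1, Quiver.quot]
  simp only [hi, hi']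
  split_ifs with h0
  · rw [h0, mul_zero]
    exact ⟨fun h => (ENat.natCast_ne_top (n + 1) (top_le_iff.1 (by exact_mod_cast h))).elim,
      fun h => by omega⟩
  · rw [← Nat.cast_succ, Nat.cast_le, Nat.ceil_le,
      div_le_iff₀ (by exact_mod_cast Nat.pos_of_ne_zero h0)]
    exact_mod_cast Iff.rfl

theorem mainTheorem1 {V : Type u} [Quiver.{v} V] [Finite V] [Finite (Quiver.Total V)]
    (hV : Quiver.Acyclic V) (k : ℕ) [NeZero k] :
    weakLocalTrivialityDim (GraphCStar.cyclicGauge V k) =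
      ⨆ (a : V) (_ : Quiver.IsSink a), (Quiver.quot a k - 1) := by
  classical
  have := fun a : V => hV.finite_pathTo a
  have := fun a : V => Fintype.ofFinite (Quiver.PathTo a)
  have hle : ∀ n : ℕ, ⨆ (a : V) (_ : Quiver.IsSink a), (Quiver.quot a k - 1) ≤ (n : ℕ∞) ↔
      ∀ a : V, Quiver.IsSink a → ∀ j j' : ZMod k,
        Quiver.pathCount a k j ≤ (n + 1) * Quiver.pathCount a k j' := fun n => by
    simp only [iSup_le_iff, tsub_le_iff_right, Quiver.quot_le_iff]
  refine le_antisymm ?_ (le_sInf ?_)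
  -- A finite supremum `n` satisfies `hle n` itself, so `n` is attained; for `⊤` nothing is to be
  -- shown.
  · generalize hR : ⨆ (a : V) (_ : Quiver.IsSink a), (Quiver.quot a k - 1) = R at hle
    cases R with
    | top => exact le_top
    | coe n =>
      exact sInf_le ⟨n, rfl, GraphCStar.exists_weakLocalTriviality hV k n ((hle n).1 le_rfl)⟩
  · rintro _ ⟨n, rfl, ρ, hρ, hu⟩
    exact (hle n).2 fun a ha =>
      CuntzKriegerFamily.pathCount_le_of_weakLocalTriviality ha n ρ hρ hu
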